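/- Let $X$ be a real Banach space with a normalized Schauder basis $(e_j)_{j\in\mathbb N}$ and coordinate functionals $(e_j^*)$ in $X^*$. **Definitions.** Sequences $(x_i)$, $(y_i)$ in normed spaces are *impartially $C$-equivalent* if $\frac1{\sqrt C}\|\sum a_iy_i\|\le\|\sum a_ix_i\|\le\sqrt C\|\sum a_iy_i\|$ for all finitely supported scalars $(a_i)$. For $C\ge1$, $\eta>0$, the game $\mathrm{Rep}_{(X,(e_j))}(C,\eta)$ is played as follows. Before the game Player I chooses a partition $\mathbb N=N_1\cup N_2$ (a part may be empty). In turn $n$: (1) Player I chooses $\eta_n>0$, a finite-codimensional subspace $W_n\subset X$ and a weak$^*$-closed finite-codimensional subspace $G_n\subset X^*$; (2) Player II chooses $i_n\in\{1,2\}$, a finite set $E_n\subset N_{i_n}$ and non-negative reals $(\lambda_i^{(n)})_{i\in E_n}$, $(\mu_i^{(n)})_{i\in E_n}$ with $1-\eta<\sum_{i\in E_n}\lambda_i^{(n)}\mu_i^{(n)}<1+\eta$; (3) Player I chooses signs $(\varepsilon_i^{(n)})_{i\in E_n}\in\{-1,1\}^{E_n}$. Put $x_n=\sum_{i\in E_n}\varepsilon_i^{(n)}\lambda_i^{(n)}e_i$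 and $x_n^*=\sum_{i\in E_n}\varepsilon_i^{(n)}\mu_i^{(n)}e_i^*$. Player II wins if $(x_n)$ and $(e_n)$ are impartially $(C+\eta)$-equivalent, $(x_n^*)$ and $(e_n^*)$ are impartially $(C+\eta)$-equivalent, and $\mathrm{dist}(x_n,W_n)<\eta_n$, $\mathrm{dist}(x_n^*,G_n)<\eta_n$ for all $n$. The basis is *$C$-strategically reproducible* if for every $\eta>0$ Player II has a winning strategy. For $K\colon(0,\infty)\to(0,\infty)$, the basis has the *$K$-diagonal factorization property* if for every $\delta>0$, every bounded linear $T\colon X\to X$ with $e_m^*(Te_j)=0$ for $m\ne j$ and $\inf_j|e_j^*(Te_j)|\ge\delta$, and every $\varepsilon>0$, there are bounded linear $A,B\colon X\to X$ with $\|A\|\|B\|\le K(\delta)+\varepsilon$ and $I_X=ATB$. Let $Z=\ell^\infty(X)$ be the space of bounded sequences in $X$ with the supremum norm; for $k,j\in\mathbb N$ let $e_{(k,j)}\in Z$ be the sequence with $e_j$ in the $k$-th component and $0$ elsewhere, and let $e^*_{(k,j)}\in Z^*$ be $(z_l)_l\mapsto e_j^*(z_k)$. The array $(e_{(k,j)})$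 is *simultaneously $C$-strategically reproducible* if for every $k$ the row $(e_{(k,j)})_j$ is $C$-strategically reproducible in the $k$-th component $X$. In game form: fix a bijection $\nu\colon\mathbb N^2\to\mathbb N$ with $\nu(k,i)<\nu(k,j)\iff i<j$; the game $\mathrm{Rep}_{(Z,(e_{(k,j)}))}(C,\eta)$ has the same turns as above, except that in turn $n=\nu(k,j)$ the spaces $W_n$, $G_n$ are subspaces of the $k$-th component and its dual, the finite set $E_n$ satisfies $\nu(k,i)\in N_{i_n}$ for all $i\in E_n$, and $x_{(k,j)}=\sum_{i\in E_n}\varepsilon_i^{(n)}\lambda_i^{(n)}e_{(k,i)}$, $x^*_{(k,j)}=\sum_{i\in E_n}\varepsilon_i^{(n)}\mu_i^{(n)}e^*_{(k,i)}$; Player II wins if for each $k$ the sequences $(x_{(k,j)})_j$, $(e_{(k,j)})_j$ and the sequences $(x^*_{(k,j)})_j$, $(e^*_{(k,j)})_j$ are impartially $(C+\eta)$-equivalent, and for all $n=\nu(k,j)$ we have $\mathrm{dist}(x_{(k,j)},W_n)<\eta_n$ and $\mathrm{dist}(x^*_{(k,j)},G_n)<\eta_n$. **Corollary 3.5.** Let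 $C\ge1$ and $K\colon(0,\infty)\to(0,\infty)$, and suppose that $(e_j)$ is $C$-strategically reproducible in $X$ and has the $K$-diagonal factorization property. Then 1. the array $(e_{(k,j)})_{k,j}$ is simultaneously $C$-strategically reproducible in $Z$; also in game form: for every $\nu$ as above and every $\eta>0$, Player II has a winning strategy in $\mathrm{Rep}_{(Z,(e_{(k,j)}))}(C,\eta)$; 2. for every bounded linear operator $T\colon Z\to Z$ with large diagonal, i.e. $\inf_{k,j}|e^*_{(k,j)}(Te_{(k,j)})|>0$, there are bounded linear operators $A,B\colon Z\to Z$ with $I_Z=ATB$. -/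

import Mathlib

noncomputable section

/-- Sequences `x` in `E` and `y` in `F` are impartially `C`-equivalent: for all finitely supported
scalars `a`, `(1/√C) ‖∑ aᵢ yᵢ‖ ≤ ‖∑ aᵢ xᵢ‖ ≤ √C ‖∑ aᵢ yᵢ‖`. -/
def ImpartiallyEquivalent {E F : Type*} [NormedAddCommGroup E] [NormedSpace ℝ E]
    [NormedAddCommGroup F] [NormedSpace ℝ F] (C : ℝ) (x : ℕ → E) (y : ℕ → F) : Prop :=
  ∀ a : ℕ →₀ ℝ,
    (1 / √C) * ‖a.sum fun i t => t • y i‖ ≤ ‖a.sum fun i t => t • x i‖ ∧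
      ‖a.sum fun i t => t • x i‖ ≤ √C * ‖a.sum fun i t => t • y i‖

/-- The identity factors through `T`: `I = A T B` with bounded linear `A`, `B`. -/
def IdentityFactorsThrough {E : Type*} [NormedAddCommGroup E] [NormedSpace ℝ E]
    (T : E →L[ℝ] E) : Prop :=
  ∃ A B : E →L[ℝ] E, A ∘L T ∘L B = ContinuousLinearMap.id ℝ E

/-- The identity `C`-factors through `T`: `I = A T B` with `‖A‖ ‖B‖ ≤ C`. -/
def IdentityFactorsThroughWith {E : Type*} [NormedAddCommGroup E] [NormedSpace ℝ E]
    (C : ℝ) (T : E →L[ℝ] E) : Prop :=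
  ∃ A B : E →L[ℝ] E, ‖A‖ * ‖B‖ ≤ C ∧ A ∘L T ∘L B = ContinuousLinearMap.id ℝ E

section Basis

variable {X : Type*} [NormedAddCommGroup X] [NormedSpace ℝ X]

/-- The matrix of `T` with respect to the basis `e` is diagonal. -/
def IsDiagonalOperator (e : SchauderBasis ℝ X) (T : X →L[ℝ] X) : Prop :=
  ∀ m j : ℕ, m ≠ j → e.coord m (T (e j)) = 0

/-- The `K(δ)`-diagonal factorization property: the identity almost `K(δ)`-factors through every
bounded diagonal operator whose diagonal entries are at least `δ` in absolute value. -/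
def HasDiagonalFactorizationProperty (e : SchauderBasis ℝ X) (K : ℝ → ℝ) : Prop :=
  ∀ δ : ℝ, 0 < δ → ∀ T : X →L[ℝ] X, IsDiagonalOperator e T →
    δ ≤ ⨅ j : ℕ, |e.coord j (T (e j))| →
      ∀ ε : ℝ, 0 < ε → IdentityFactorsThroughWith (K δ + ε) T

variable (X) in
/-- What Player I chooses in the first step of a turn: a tolerance, a finite-codimensional
subspace of `X`, and a weak*-closed finite-codimensional subspace of the dual of `X`. -/
structure RepMoveOne where
  tol : ℝ
  tol_pos : 0 < tol
  W : Submodule ℝ X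
  finite_codim_W : FiniteDimensional ℝ (X ⧸ W)
  G : Submodule ℝ (StrongDual ℝ X)
  finite_codim_G : FiniteDimensional ℝ (StrongDual ℝ X ⧸ G)
  weakStar_closed_G : IsClosed {f : WeakDual ℝ X | WeakDual.toStrongDual f ∈ G}

/-- What Player II chooses in the second step of a turn: one of the two parts of the partition,
a finite set `E` of indices, and coefficients (only their values on `E` matter). -/
structure RepMoveTwo where
  side : Fin 2
  E : Finset ℕ
  lam : ℕ → ℝ
  mu : ℕ → ℝ

/-- The rules for Player II's move. The map `c` encodes the partition as the two sets
`{i | c i = 0}` and `{i | c i = 1}`. -/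
def RepMoveTwo.Legal (m : RepMoveTwo) (η : ℝ) (c : ℕ → Fin 2) : Prop :=
  (∀ i ∈ m.E, c i = m.side) ∧
  (∀ i ∈ m.E, 0 ≤ m.lam i ∧ 0 ≤ m.mu i) ∧
  1 - η < ∑ i ∈ m.E, m.lam i * m.mu i ∧ ∑ i ∈ m.E, m.lam i * m.mu i < 1 + η

/-- The vector `∑_{i ∈ E} εᵢ λᵢ eᵢ` (the signs are given on all of `ℕ`; only those in `E` matter). -/
def RepMoveTwo.vec (m : RepMoveTwo) (e : SchauderBasis ℝ X) (ε : ℕ → ℤˣ) : X :=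
  ∑ i ∈ m.E, (((ε i : ℤ) : ℝ) * m.lam i) • e i

/-- The functional `∑_{i ∈ E} εᵢ μᵢ eᵢ*`. -/
def RepMoveTwo.covec (m : RepMoveTwo) (e : SchauderBasis ℝ X) (ε : ℕ → ℤˣ) : StrongDual ℝ X :=
  ∑ i ∈ m.E, (((ε i : ℤ) : ℝ) * m.mu i) • e.coord i

variable (X) in
/-- A strategy of Player II. His move in turn `n` depends on the partition `c` of `ℕ` chosen before
the game, on Player I's first-step moves in the turns `0, …, n`, and on the signs which Player I
chose in the third step of the turns `0, …, n - 1`. -/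
def RepStrategy : Type _ :=
  (ℕ → Fin 2) → (n : ℕ) → (Fin (n + 1) → RepMoveOne X) → (Fin n → ℕ → ℤˣ) → RepMoveTwo

/-- Player II's move in turn `n` if he follows `σ` and Player I plays `c`, `p`, `ε`. -/
def RepStrategy.move (σ : RepStrategy X) (c : ℕ → Fin 2) (p : ℕ → RepMoveOne X)
    (ε : ℕ → ℕ → ℤˣ) (n : ℕ) : RepMoveTwo :=
  σ c n (fun m => p m) (fun m => ε m)

/-- Player II has a winning strategy in the game `Rep_{(X,(e_j))}(C, η)`. -/
def PlayerTwoWinsRep (e : SchauderBasis ℝ X) (C η : ℝ) : Prop :=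
  ∃ σ : RepStrategy X, ∀ (c : ℕ → Fin 2) (p : ℕ → RepMoveOne X) (ε : ℕ → ℕ → ℤˣ),
    (∀ n, (σ.move c p ε n).Legal η c) ∧
    ImpartiallyEquivalent (C + η) (fun n => (σ.move c p ε n).vec e (ε n)) (fun j => e j) ∧
    ImpartiallyEquivalent (C + η) (fun n => (σ.move c p ε n).covec e (ε n)) e.coord ∧
    (∀ n, Metric.infDist ((σ.move c p ε n).vec e (ε n)) ((p n).W : Set X) < (p n).tol) ∧
    (∀ n, Metric.infDist ((σ.move c p ε n).covec e (ε n)) ((p n).G : Set (StrongDual ℝ X))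
      < (p n).tol)

/-- The basis `e` is `C`-strategically reproducible in `X`. -/
def IsStrategicallyReproducible (e : SchauderBasis ℝ X) (C : ℝ) : Prop :=
  ∀ η : ℝ, 0 < η → PlayerTwoWinsRep e C η

/-- The array whose `k`-th row is the basis `e k` of the `k`-th component is simultaneously
`C`-strategically reproducible: every row is `C`-strategically reproducible. -/
def IsSimultaneouslyStrategicallyReproducible (e : ℕ → SchauderBasis ℝ X) (C : ℝ) : Prop :=
  ∀ k : ℕ, IsStrategicallyReproducible (e k) C

/-- Player II has a winning strategy in the game `Rep_{(Z,(e_{(k,j)}))}(C, η)` on the whole array,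
where the array is enumerated by `ν`. Turn `n = ν (k, j)` is played in row `k`: the partition `c` is
one of the index set `ℕ` of the enumerated array, Player I's subspaces belong to the `k`-th
component and its dual, and Player II chooses a finite set of indices `i` of elements `e_{(k,i)}`
of the `k`-th row for which the positions `ν (k, i)` lie in one part of the partition. -/
def PlayerTwoWinsArrayRep (ν : ℕ × ℕ ≃ ℕ) (e : ℕ → SchauderBasis ℝ X) (C η : ℝ) : Prop :=
  ∃ σ : RepStrategy X, ∀ (c : ℕ → Fin 2) (p : ℕ → RepMoveOne X) (ε : ℕ → ℕ → ℤˣ),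
    (∀ k j, (σ.move c p ε (ν (k, j))).Legal η fun i => c (ν (k, i))) ∧
    (∀ k, ImpartiallyEquivalent (C + η)
      (fun j => (σ.move c p ε (ν (k, j))).vec (e k) (ε (ν (k, j)))) (fun j => e k j)) ∧
    (∀ k, ImpartiallyEquivalent (C + η)
      (fun j => (σ.move c p ε (ν (k, j))).covec (e k) (ε (ν (k, j)))) (e k).coord) ∧
    (∀ k j, Metric.infDist ((σ.move c p ε (ν (k, j))).covec (e k) (ε (ν (k, j))))
      ((p (ν (k, j))).G : Set (StrongDual ℝ X)) < (p (ν (k, j))).tol) ∧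
    (∀ k j, Metric.infDist ((σ.move c p ε (ν (k, j))).vec (e k) (ε (ν (k, j))))
      ((p (ν (k, j))).W : Set X) < (p (ν (k, j))).tol)

end Basis

/-- The space `ℓ^∞(X)` of bounded sequences in `X` with the supremum norm. -/
abbrev LInftySum (X : Type*) [NormedAddCommGroup X] : Type _ := lp (fun _ : ℕ => X) ⊤

section Array

variable {X : Type*} [NormedAddCommGroup X] [NormedSpace ℝ X]

/-- The element `e_{(k,j)}` of `ℓ^∞(X)`: the vector `e j` in the `k`-th component. -/
def arrayVec (e : SchauderBasis ℝ X) (k j : ℕ) : LInftySum X :=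
  lp.single ⊤ k (e j)

/-- The functional `e*_{(k,j)}` on `ℓ^∞(X)`: the `j`-th coordinate of the `k`-th component. -/
def arrayCoord (e : SchauderBasis ℝ X) (k j : ℕ) : StrongDual ℝ (LInftySum X) :=
  e.coord j ∘L lp.evalCLM ℝ (fun _ : ℕ => X) ⊤ k

/-- `T` has large diagonal: `inf_{k,j} |e*_{(k,j)}(T e_{(k,j)})| > 0`. -/
def HasLargeDiagonal (e : SchauderBasis ℝ X) (T : LInftySum X →L[ℝ] LInftySum X) : Prop :=
  0 < ⨅ q : ℕ × ℕ, |arrayCoord e q.1 q.2 (T (arrayVec e q.1 q.2))|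

end Array

end

/-! The array game splits into independent games, one per row: Player II runs a separate copy of the
given strategy on each row.

For the factorization, the obstacle is that functionals on `ℓ^∞(X)` may vanish on all finitely
supported sequences, so the matrix of `T` does not determine `T`. Normal functionals, whose norms on
tails tend to zero, have no such defect. Vectors of norm at most one with disjoint supports sum to a
vector of norm at most one, so a fixed functional is non-normal on at most countably many members of
an almost disjoint family of subsets of `ℕ`. Such a family of size continuum exists, hence all the
countably many functionals `e*_{(k,j)} ∘ T` are normal along one subsequence of components
(`exists_normal_subsequence`). Compressing `T` to it keeps the diagonal large.

For normal coordinates, Player I plays the array game against `T` (`exists_almost_diagonal`): the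
subspaces make the off-diagonal entries tiny, while the partition by sign and the choice of signs
keep the diagonal large. The resulting blocks define row-wise operators `A₁`, `B₁`, and `S = A₁ T
B₁` has an off-diagonal part which is the matrix of an operator `N` of small norm
(`exists_clm_of_summable_matrix`). Normality turns the diagonal matrix of `S - N` into a
decomposition into diagonal operators on the rows, which factor the identity with uniform bounds
(`exists_factors`): `A₂ (S - N) B₂ = I`. So `A₂ S B₂ = I + A₂ N B₂` is invertible by a Neumann
series. -/

open Filter Topology

noncomputable section

/-! ### Schauder bases and strong limits -/

namespace SchauderBasis

variable {X : Type*} [NormedAddCommGroup X] [NormedSpace ℝ X] (e : SchauderBasis ℝ X)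

theorem coord_self (i : ℕ) : e.coord i (e i) = 1 := by simp [e.ortho]

theorem coord_of_ne {i j : ℕ} (h : i ≠ j) : e.coord i (e j) = 0 := by simp [e.ortho, h]

theorem eq_of_coord {x y : X} (h : ∀ j, e.coord j x = e.coord j y) : x = y := by
  refine tendsto_nhds_unique (e.tendsto_proj x) ?_
  simpa [h] using e.tendsto_proj y

theorem clm_ext {V : Type*} [NormedAddCommGroup V] [NormedSpace ℝ V] {f g : X →L[ℝ] V}
    (h : ∀ i, f (e i) = g (e i)) : f = g := by
  ext x
  refine tendsto_nhds_unique ((f.continuous.tendsto x).comp (e.tendsto_proj x)) ?_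
  refine ((g.continuous.tendsto x).comp (e.tendsto_proj x)).congr fun n => ?_
  simp [h]

theorem exists_one_le_norm_proj_le [CompleteSpace X] :
    ∃ κ : ℝ, 1 ≤ κ ∧ ∀ n, ‖e.proj n‖ ≤ κ := by
  obtain ⟨C, hC⟩ := e.exists_norm_proj_le
  exact ⟨max 1 C, le_max_left _ _, fun n => (hC n).trans (le_max_right _ _)⟩

theorem norm_coord_le (he : ∀ j, ‖e j‖ = 1) {κ : ℝ} (hκ : ∀ n, ‖e.proj n‖ ≤ κ) (j : ℕ) :
    ‖e.coord j‖ ≤ 2 * κ := by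
  have h0 : 0 ≤ κ := (norm_nonneg _).trans (hκ 0)
  refine ContinuousLinearMap.opNorm_le_bound _ (by positivity) fun x => ?_
  have h : e.coord j x • e j = e.proj (j + 1) x - e.proj j x := by
    simp [Finset.sum_range_succ]
  calc ‖e.coord j x‖ = ‖e.coord j x • e j‖ := by rw [norm_smul, he, mul_one]
    _ ≤ ‖e.proj (j + 1) x‖ + ‖e.proj j x‖ := by rw [h]; exact norm_sub_le _ _
    _ ≤ κ * ‖x‖ + κ * ‖x‖ := by
      gcongr
      · exact (e.proj (j + 1)).le_of_opNorm_le (hκ _) x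
      · exact (e.proj j).le_of_opNorm_le (hκ _) x
    _ = 2 * κ * ‖x‖ := by ring

/-- A bounded sequence of operators which converges on the basis converges strongly. -/
theorem exists_strong_limit [CompleteSpace X] {S : ℕ → X →L[ℝ] X} {M : ℝ} (hM : ∀ n, ‖S n‖ ≤ M)
    (hS : ∀ i, CauchySeq fun n => S n (e i)) :
    ∃ L : X →L[ℝ] X, ‖L‖ ≤ M ∧ ∀ x, Tendsto (fun n => S n x) atTop (𝓝 (L x)) := by
  have hM0 : 0 ≤ M := (norm_nonneg _).trans (hM 0)
  have hc : ∀ x, CauchySeq fun n => S n x := by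
    intro x
    have hp : ∀ N, CauchySeq fun n => S n (e.proj N x) := by
      intro N
      have : ∀ i, ∃ y, Tendsto (fun n => S n (e i)) atTop (𝓝 y) :=
        fun i => cauchySeq_tendsto_of_complete (hS i)
      choose y hy using this
      have h2 : Tendsto (fun n => ∑ i ∈ Finset.range N, e.coord i x • S n (e i)) atTop
          (𝓝 (∑ i ∈ Finset.range N, e.coord i x • y i)) :=
        tendsto_finsetSum _ fun i _ => (hy i).const_smul _
      refine (h2.congr fun n => ?_).cauchySeq
      simp
    rw [Metric.cauchySeq_iff']
    intro ε hε
    have hδ : 0 < ε / (3 * (M + 1)) := by positivity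
    obtain ⟨N, hN⟩ := (Metric.tendsto_atTop.1 (e.tendsto_proj x)) _ hδ
    have hNx : ‖x - e.proj N x‖ < ε / (3 * (M + 1)) := by
      rw [← dist_eq_norm, dist_comm]; exact hN N le_rfl
    obtain ⟨K, hK⟩ := Metric.cauchySeq_iff'.1 (hp N) (ε / 3) (by positivity)
    have hb : ∀ n, ‖S n (x - e.proj N x)‖ ≤ ε / 3 := by
      intro n
      calc ‖S n (x - e.proj N x)‖ ≤ M * ‖x - e.proj N x‖ := (S n).le_of_opNorm_le (hM n) _
        _ ≤ (M + 1) * (ε / (3 * (M + 1))) := by gcongr; linarith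
        _ = ε / 3 := by field_simp
    refine ⟨K, fun n hn => ?_⟩
    have h1 := hK n hn
    rw [dist_eq_norm] at h1 ⊢
    have h2 : S n x - S K x = S n (x - e.proj N x) - S K (x - e.proj N x)
        + (S n (e.proj N x) - S K (e.proj N x)) := by
      simp only [map_sub]; abel
    rw [h2]
    calc _ ≤ ‖S n (x - e.proj N x)‖ + ‖S K (x - e.proj N x)‖
        + ‖S n (e.proj N x) - S K (e.proj N x)‖ :=
          (norm_add_le _ _).trans (add_le_add_left (norm_sub_le _ _) _)
      _ < ε := by linarith [hb n, hb K]
  choose L hL using fun x => cauchySeq_tendsto_of_complete (hc x)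
  let L' : X →ₗ[ℝ] X :=
    { toFun := L
      map_add' := fun x y => tendsto_nhds_unique (hL (x + y))
        (((hL x).add (hL y)).congr fun n => by simp)
      map_smul' := fun c x => tendsto_nhds_unique (hL (c • x))
        (((hL x).const_smul c).congr fun n => by simp) }
  have hb : ∀ x, ‖L' x‖ ≤ M * ‖x‖ := fun x =>
    le_of_tendsto (hL x).norm (Eventually.of_forall fun n => (S n).le_of_opNorm_le (hM n) x)
  exact ⟨L'.mkContinuous M hb, L'.mkContinuous_norm_le hM0 hb, fun x => hL x⟩

end SchauderBasis

/-! ### Operators induced by sequences equivalent to the basis -/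

theorem Finsupp.sum_sum_single_smul {G : Type*} [NormedAddCommGroup G] [NormedSpace ℝ G]
    (s : Finset ℕ) (a : ℕ → ℝ) (z : ℕ → G) :
    ((∑ i ∈ s, Finsupp.single i (a i)).sum fun i t => t • z i) = ∑ i ∈ s, a i • z i := by
  rw [← Finsupp.sum_finsetSum_index (fun _ => by simp) (fun _ _ _ => by simp [add_smul])]
  simp

theorem ImpartiallyEquivalent.norm_sum_le {E F : Type*} [NormedAddCommGroup E] [NormedSpace ℝ E]
    [NormedAddCommGroup F] [NormedSpace ℝ F] {C : ℝ} {x : ℕ → E} {y : ℕ → F}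
    (h : ImpartiallyEquivalent C x y) (s : Finset ℕ) (a : ℕ → ℝ) :
    ‖∑ i ∈ s, a i • x i‖ ≤ √C * ‖∑ i ∈ s, a i • y i‖ := by
  simpa only [Finsupp.sum_sum_single_smul] using (h (∑ i ∈ s, Finsupp.single i (a i))).2

theorem ImpartiallyEquivalent.norm_le {E F : Type*} [NormedAddCommGroup E] [NormedSpace ℝ E]
    [NormedAddCommGroup F] [NormedSpace ℝ F] {C : ℝ} {x : ℕ → E} {y : ℕ → F}
    (h : ImpartiallyEquivalent C x y) (i : ℕ) : ‖x i‖ ≤ √C * ‖y i‖ := by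
  simpa using h.norm_sum_le {i} 1

namespace SchauderBasis

variable {X : Type*} [NormedAddCommGroup X] [NormedSpace ℝ X] [CompleteSpace X]
  (e : SchauderBasis ℝ X)

theorem exists_clm_of_vectors {κ c : ℝ} (hκ : ∀ n, ‖e.proj n‖ ≤ κ) {x : ℕ → X}
    (hx : ImpartiallyEquivalent c x fun j => e j) :
    ∃ B : X →L[ℝ] X, ‖B‖ ≤ √c * κ ∧ ∀ i, B (e i) = x i := by
  have h0 : 0 ≤ κ := (norm_nonneg _).trans (hκ 0)
  let S : ℕ → X →L[ℝ] X := fun n => ∑ j ∈ Finset.range n, (e.coord j).smulRight (x j)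
  have hSx : ∀ n y, S n y = ∑ j ∈ Finset.range n, e.coord j y • x j := fun n y => by simp [S]
  have hS : ∀ n, ‖S n‖ ≤ √c * κ := by
    intro n
    refine ContinuousLinearMap.opNorm_le_bound _ (by positivity) fun y => ?_
    rw [hSx]
    refine (hx.norm_sum_le _ _).trans ?_
    rw [← e.proj_apply, mul_assoc]
    gcongr
    exact (e.proj n).le_of_opNorm_le (hκ n) y
  have hSe : ∀ i, Tendsto (fun n => S n (e i)) atTop (𝓝 (x i)) := by
    intro i
    refine tendsto_const_nhds.congr' ?_
    filter_upwards [eventually_gt_atTop i] with n hn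
    rw [hSx, Finset.sum_eq_single i]
    · simp [e.coord_self]
    · intro j _ hj; simp [e.coord_of_ne hj]
    · intro h; simp at h; omega
  obtain ⟨B, hB, hlim⟩ := e.exists_strong_limit hS fun i => (hSe i).cauchySeq
  exact ⟨B, hB, fun i => tendsto_nhds_unique (hlim _) (hSe i)⟩

/-- The operator is `w ↦ ∑ f j w • e j`. Testing a partial sum against a norming `g` gives `∑ g (e
j) • f j`, which equivalence compares with `∑ g (e j) • e.coord j = g ∘ e.proj n`; this bounds the
partial sums uniformly. The summability hypothesis gives their convergence on the basis. -/
theorem exists_clm_of_functionals (he : ∀ j, ‖e j‖ = 1) {κ c : ℝ} (hκ : ∀ n, ‖e.proj n‖ ≤ κ)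
    {f : ℕ → StrongDual ℝ X} (hf : ImpartiallyEquivalent c f e.coord)
    (hs : ∀ i, Summable fun j => |f j (e i)|) :
    ∃ A : X →L[ℝ] X, ‖A‖ ≤ √c * κ ∧ ∀ j w, e.coord j (A w) = f j w := by
  have h0 : 0 ≤ κ := (norm_nonneg _).trans (hκ 0)
  let S : ℕ → X →L[ℝ] X := fun n => ∑ j ∈ Finset.range n, (f j).smulRight (e j)
  have hSx : ∀ n y, S n y = ∑ j ∈ Finset.range n, f j y • e j := fun n y => by simp [S]
  have hS : ∀ n, ‖S n‖ ≤ √c * κ := by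
    intro n
    refine ContinuousLinearMap.opNorm_le_bound _ (by positivity) fun y => ?_
    obtain ⟨g, hg, hgy⟩ := exists_dual_vector'' ℝ (S n y)
    have h1 : g (S n y) = (∑ j ∈ Finset.range n, g (e j) • f j) y := by
      rw [hSx]; simp [mul_comm]
    have h2 : ∑ j ∈ Finset.range n, g (e j) • e.coord j = g ∘L e.proj n := by
      ext w; simp [mul_comm]
    calc ‖S n y‖ = g (S n y) := by rw [hgy]; simp
      _ ≤ ‖(∑ j ∈ Finset.range n, g (e j) • f j) y‖ := by rw [h1]; exact le_abs_self _
      _ ≤ (√c * ‖g ∘L e.proj n‖) * ‖y‖ := by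
        refine ContinuousLinearMap.le_of_opNorm_le _ ?_ y
        rw [← h2]
        exact hf.norm_sum_le _ _
      _ ≤ (√c * (1 * κ)) * ‖y‖ := by
        gcongr
        exact (ContinuousLinearMap.opNorm_comp_le _ _).trans
          (mul_le_mul hg (hκ n) (norm_nonneg _) zero_le_one)
      _ = √c * κ * ‖y‖ := by ring
  have hSe : ∀ i, CauchySeq fun n => S n (e i) := by
    intro i
    have : Summable fun j => f j (e i) • e j := by
      refine Summable.of_norm ?_
      simpa [norm_smul, he] using hs i
    refine (this.hasSum.tendsto_sum_nat.congr fun n => ?_).cauchySeq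
    rw [hSx]
  obtain ⟨A, hA, hlim⟩ := e.exists_strong_limit hS hSe
  refine ⟨A, hA, fun j w => ?_⟩
  refine tendsto_nhds_unique (((e.coord j).continuous.tendsto _).comp (hlim w)) ?_
  refine tendsto_const_nhds.congr' ?_
  filter_upwards [eventually_gt_atTop j] with n hn
  simp only [Function.comp, hSx, map_sum, map_smul, smul_eq_mul]
  rw [Finset.sum_eq_single j]
  · simp [e.coord_self]
  · intro i _ hi; simp [e.coord_of_ne hi.symm]
  · intro h; simp at h; omega

end SchauderBasis

/-! ### Row-wise operators on `ℓ^∞(X)` -/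

namespace LInftySum

variable {X : Type*} [NormedAddCommGroup X] [NormedSpace ℝ X]

theorem exists_clm_of_rows {V : Type*} [NormedAddCommGroup V] [NormedSpace ℝ V]
    (F : ℕ → V →L[ℝ] X) {M : ℝ} (hM : ∀ k, ‖F k‖ ≤ M) :
    ∃ L : V →L[ℝ] LInftySum X, ‖L‖ ≤ M ∧ ∀ v k, L v k = F k v := by
  have h0 : 0 ≤ M := (norm_nonneg _).trans (hM 0)
  have hb : ∀ v k, ‖F k v‖ ≤ M * ‖v‖ := fun v k => (F k).le_of_opNorm_le (hM k) v
  let L' : V →ₗ[ℝ] LInftySum X :=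
    { toFun := fun v => ⟨fun k => F k v, memℓp_infty ⟨M * ‖v‖, by rintro _ ⟨k, rfl⟩; exact hb v k⟩⟩
      map_add' := fun v w => by ext k; exact map_add (F k) v w
      map_smul' := fun c v => by ext k; exact map_smul (F k) c v }
  have hL : ∀ v, ‖L' v‖ ≤ M * ‖v‖ := fun v =>
    lp.norm_le_of_forall_le (by positivity) fun k => hb v k
  exact ⟨L'.mkContinuous M hL, L'.mkContinuous_norm_le h0 hL, fun v k => rfl⟩

theorem norm_evalCLM_le (k : ℕ) : ‖lp.evalCLM ℝ (fun _ : ℕ => X) ⊤ k‖ ≤ 1 :=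
  ContinuousLinearMap.opNorm_le_bound _ zero_le_one fun z => by
    rw [one_mul]; exact lp.norm_apply_le_norm (by simp) z k

theorem evalCLM_apply (k : ℕ) (z : LInftySum X) : lp.evalCLM ℝ (fun _ : ℕ => X) ⊤ k z = z k := rfl

/-- The embedding of the `l`-th component. -/
def incl (l : ℕ) : X →L[ℝ] LInftySum X :=
  lp.singleContinuousLinearMap ℝ (fun _ : ℕ => X) ⊤ l

theorem incl_apply (l : ℕ) (x : X) : incl l x = lp.single ⊤ l x := rfl

theorem norm_incl_apply (l : ℕ) (x : X) : ‖incl l x‖ = ‖x‖ := by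
  rw [incl_apply]; exact lp.norm_single (E := fun _ : ℕ => X) ENNReal.zero_lt_top l x

theorem incl_apply_self (l : ℕ) (x : X) : incl l x l = x := by
  rw [incl_apply]; exact lp.single_apply_self ..

theorem incl_apply_ne {l k : ℕ} (h : k ≠ l) (x : X) : incl l x k = 0 := by
  rw [incl_apply]; exact lp.single_apply_ne _ _ _ h

theorem clm_apply_incl {L : LInftySum X →L[ℝ] LInftySum X} {F : ℕ → X →L[ℝ] X}
    (hL : ∀ z k, L z k = F k (z k)) (l : ℕ) (x : X) : L (incl l x) = incl l (F l x) := by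
  ext k
  rw [hL]
  by_cases h : k = l
  · subst h; rw [incl_apply_self, incl_apply_self]
  · rw [incl_apply_ne h, incl_apply_ne h, map_zero]

theorem exists_clm_of_diagonal (F : ℕ → X →L[ℝ] X) {M : ℝ} (hM : ∀ k, ‖F k‖ ≤ M) :
    ∃ L : LInftySum X →L[ℝ] LInftySum X, ‖L‖ ≤ M ∧ ∀ z k, L z k = F k (z k) := by
  refine exists_clm_of_rows (fun k => F k ∘L lp.evalCLM ℝ (fun _ : ℕ => X) ⊤ k) fun k => ?_
  exact (ContinuousLinearMap.opNorm_comp_le _ _).trans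
    ((mul_le_mul (hM k) (norm_evalCLM_le k) (norm_nonneg _)
      ((norm_nonneg _).trans (hM k))).trans_eq (mul_one M))

/-! ### Normal functionals -/

/-- A functional on `ℓ^∞(X)` is normal if its restrictions to the tails tend to zero in norm. -/
def IsNormal (h : StrongDual ℝ (LInftySum X)) : Prop :=
  ∀ ε : ℝ, 0 < ε → ∃ N : ℕ, ∀ z : LInftySum X, (∀ l < N, z l = 0) → |h z| ≤ ε * ‖z‖

theorem isNormal_zero : IsNormal (0 : StrongDual ℝ (LInftySum X)) := fun ε hε =>
  ⟨0, fun z _ => by simp; positivity⟩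

theorem IsNormal.add {f g : StrongDual ℝ (LInftySum X)} (hf : IsNormal f) (hg : IsNormal g) :
    IsNormal (f + g) := fun ε hε => by
  obtain ⟨N, hN⟩ := hf (ε / 2) (by positivity)
  obtain ⟨K, hK⟩ := hg (ε / 2) (by positivity)
  refine ⟨max N K, fun z hz => ?_⟩
  have h1 := hN z fun l hl => hz l (hl.trans_le (le_max_left _ _))
  have h2 := hK z fun l hl => hz l (hl.trans_le (le_max_right _ _))
  calc |f z + g z| ≤ |f z| + |g z| := abs_add_le _ _
    _ ≤ ε * ‖z‖ := by linarith

theorem IsNormal.smul {f : StrongDual ℝ (LInftySum X)} (hf : IsNormal f) (c : ℝ) :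
    IsNormal (c • f) := fun ε hε => by
  obtain ⟨N, hN⟩ := hf (ε / (|c| + 1)) (by positivity)
  refine ⟨N, fun z hz => ?_⟩
  have h1 := hN z hz
  calc |c * f z| = |c| * |f z| := abs_mul _ _
    _ ≤ (|c| + 1) * (ε / (|c| + 1) * ‖z‖) := by gcongr; linarith
    _ = ε * ‖z‖ := by field_simp

theorem IsNormal.sub {f g : StrongDual ℝ (LInftySum X)} (hf : IsNormal f) (hg : IsNormal g) :
    IsNormal (f - g) := by
  have := hf.add (hg.smul (-1))
  rwa [neg_one_smul ℝ g, ← sub_eq_add_neg] at this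

variable (X) in
/-- The subspace of normal functionals. -/
def normalSubmodule : Submodule ℝ (StrongDual ℝ (LInftySum X)) where
  carrier := {f | IsNormal f}
  add_mem' hf hg := IsNormal.add hf hg
  zero_mem' := isNormal_zero
  smul_mem' c _ hf := IsNormal.smul hf c

/-- Needed to pass normality from the partial sums of a norm convergent series of operators to its
sum. -/
theorem isClosed_normal : IsClosed {f : StrongDual ℝ (LInftySum X) | IsNormal f} := by
  refine isClosed_of_closure_subset fun f hf ε hε => ?_
  obtain ⟨g, hg, hfg⟩ := Metric.mem_closure_iff.1 hf (ε / 2) (by positivity)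
  obtain ⟨N, hN⟩ := hg (ε / 2) (by positivity)
  refine ⟨N, fun z hz => ?_⟩
  have h1 : |(f - g) z| ≤ ε / 2 * ‖z‖ := by
    refine (f - g).le_of_opNorm_le ?_ z
    rw [← dist_eq_norm]; exact hfg.le
  calc |f z| = |(f - g) z + g z| := by simp
    _ ≤ |(f - g) z| + |g z| := abs_add_le _ _
    _ ≤ ε * ‖z‖ := by linarith [hN z hz]

theorem isNormal_comp_eval (f : StrongDual ℝ X) (k : ℕ) :
    IsNormal (f ∘L lp.evalCLM ℝ (fun _ : ℕ => X) ⊤ k) := fun ε hε =>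
  ⟨k + 1, fun z hz => by
    simp only [ContinuousLinearMap.comp_apply, evalCLM_apply]
    rw [hz k (by omega)]; simp; positivity⟩

theorem IsNormal.comp_diagonal {f : StrongDual ℝ (LInftySum X)} (hf : IsNormal f)
    {L : LInftySum X →L[ℝ] LInftySum X} {F : ℕ → X →L[ℝ] X} (hL : ∀ z k, L z k = F k (z k)) :
    IsNormal (f ∘L L) := fun ε hε => by
  obtain ⟨N, hN⟩ := hf (ε / (‖L‖ + 1)) (by positivity)
  refine ⟨N, fun z hz => ?_⟩
  have h1 := hN (L z) fun l hl => by rw [hL, hz l hl, map_zero]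
  calc |f (L z)| ≤ ε / (‖L‖ + 1) * ‖L z‖ := h1
    _ ≤ ε / (‖L‖ + 1) * ((‖L‖ + 1) * ‖z‖) := by
      gcongr
      exact (L.le_opNorm z).trans (by gcongr; linarith)
    _ = ε * ‖z‖ := by field_simp

/-- The projection onto the components with index at least `N`. -/
theorem exists_tail (N : ℕ) : ∃ P : LInftySum X →L[ℝ] LInftySum X, ‖P‖ ≤ 1 ∧
    ∀ z k, P z k = if k < N then 0 else z k := by
  obtain ⟨P, hP, h⟩ := exists_clm_of_diagonal
    (fun k => if k < N then (0 : X →L[ℝ] X) else ContinuousLinearMap.id ℝ X) (M := 1) fun k => by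
      split_ifs
      · simp
      · exact ContinuousLinearMap.norm_id_le
  refine ⟨P, hP, fun z k => ?_⟩
  rw [h]; split_ifs <;> simp

/-- Removing finitely many components from `z` does not change `f z`, and leaves a tail on which `f`
is arbitrarily small. -/
theorem IsNormal.eq_zero {f : StrongDual ℝ (LInftySum X)} (hf : IsNormal f)
    (h0 : ∀ l x, f (incl l x) = 0) : f = 0 := by
  ext z
  rw [zero_apply, ← abs_nonpos_iff]
  refine le_of_forall_pos_le_add fun ε hε => ?_
  obtain ⟨N, hN⟩ := hf (ε / (‖z‖ + 1)) (by positivity)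
  obtain ⟨P, hP, hPz⟩ := exists_tail (X := X) N
  have h1 : z = P z + ∑ l ∈ Finset.range N, incl l (z l) := by
    ext k
    rw [lp.coeFn_add, lp.coeFn_sum, Pi.add_apply, hPz, Finset.sum_apply]
    by_cases hk : k < N
    · rw [Finset.sum_eq_single k (fun l _ hl => incl_apply_ne hl.symm _)
        (fun h => by simp at h; omega), incl_apply_self]
      simp [hk]
    · rw [Finset.sum_eq_zero fun l hl => incl_apply_ne (by simp at hl; omega) _]
      simp [hk]
  have h2 : f z = f (P z) := by
    conv_lhs => rw [h1]
    simp [h0]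
  have h3 := hN (P z) fun l hl => by rw [hPz, if_pos hl]
  rw [h2, zero_add]
  calc |f (P z)| ≤ ε / (‖z‖ + 1) * ‖P z‖ := h3
    _ ≤ ε / (‖z‖ + 1) * (1 * ‖z‖) := by gcongr; exact P.le_of_opNorm_le hP z
    _ ≤ ε / (‖z‖ + 1) * (‖z‖ + 1) := by gcongr; linarith
    _ = ε := by field_simp

/-! ### Almost disjoint subsequences and normality -/

open Classical in
theorem exists_extend {φ : ℕ → ℕ} (hφ : φ.Injective) :
    ∃ J : LInftySum X →L[ℝ] LInftySum X, ‖J‖ ≤ 1 ∧ (∀ z k, J z (φ k) = z k) ∧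
      ∀ z k, (∀ l, φ l ≠ k) → J z k = 0 := by
  obtain ⟨J, hJ, h⟩ := exists_clm_of_rows (V := LInftySum X)
    (fun k => if h : ∃ l, φ l = k then lp.evalCLM ℝ (fun _ : ℕ => X) ⊤ h.choose else 0)
    (M := 1) fun k => by
      split_ifs with h
      · exact norm_evalCLM_le _
      · simp
  refine ⟨J, hJ, fun z k => ?_, fun z k hk => ?_⟩
  · have hk : ∃ l, φ l = φ k := ⟨k, rfl⟩
    rw [h, dif_pos hk, evalCLM_apply, hφ hk.choose_spec]
  · rw [h, dif_neg (by simpa using hk)]; rfl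

theorem exists_reindex (φ : ℕ → ℕ) :
    ∃ R : LInftySum X →L[ℝ] LInftySum X, ∀ z k, R z k = z (φ k) := by
  obtain ⟨R, -, h⟩ := exists_clm_of_rows (V := LInftySum X)
    (fun k => lp.evalCLM ℝ (fun _ : ℕ => X) ⊤ (φ k)) fun k => norm_evalCLM_le _
  exact ⟨R, h⟩

/-- The codes of the initial segments of `a`; distinct `a` have almost disjoint ranges. -/
def branch (a : ℕ → Bool) (n : ℕ) : ℕ := Encodable.encode ((List.range n).map a)

theorem branch_eq_iff {a b : ℕ → Bool} {m n : ℕ} :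
    branch a m = branch b n ↔ m = n ∧ ∀ i < n, a i = b i := by
  rw [branch, branch, Encodable.encode_inj]
  constructor
  · intro h
    have hl : m = n := by simpa using congrArg List.length h
    subst hl
    exact ⟨rfl, fun i hi => by simpa using List.map_inj_left.1 h i (by simpa using hi)⟩
  · rintro ⟨rfl, h⟩
    exact List.map_inj_left.2 fun i hi => h i (by simpa using hi)

theorem branch_injective (a : ℕ → Bool) : (branch a).Injective := fun _ _ h =>
  (branch_eq_iff.1 h).1

theorem exists_branch_disjoint (s : Finset (ℕ → Bool)) :
    ∃ N : ℕ, ∀ a ∈ s, ∀ b ∈ s, a ≠ b → ∀ m n, N ≤ n → branch a m ≠ branch b n := by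
  have h : ∀ q : (ℕ → Bool) × (ℕ → Bool), ∃ N, q.1 ≠ q.2 → ∀ m n, N ≤ n →
      branch q.1 m ≠ branch q.2 n := by
    rintro ⟨a, b⟩
    by_cases hab : a = b
    · exact ⟨0, fun h => absurd hab h⟩
    -- A common code forces prefixes of equal length `n`; with `n ≥ i + 1` they contain the position
    -- `i` where `a` and `b` differ.
    · obtain ⟨i, hi⟩ := Function.ne_iff.1 hab
      exact ⟨i + 1, fun _ m n hn he => hi ((branch_eq_iff.1 he).2 i (by omega))⟩
  choose N hN using h
  refine ⟨(s ×ˢ s).sup N, fun a ha b hb hab m n hn => hN (a, b) hab m n (le_trans ?_ hn)⟩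
  exact Finset.le_sup (f := N) (Finset.mk_mem_product ha hb)

/-- For each `ε`, only boundedly many members of an almost disjoint family carry tails on which a
given functional is at least `ε`. -/
theorem card_le_of_not_normal {J : (ℕ → Bool) → LInftySum X →L[ℝ] LInftySum X}
    (hJ1 : ∀ a z k, J a z (branch a k) = z k)
    (hJ2 : ∀ a z k, (∀ l, branch a l ≠ k) → J a z k = 0)
    (f : StrongDual ℝ (LInftySum X)) {ε : ℝ} (s : Finset (ℕ → Bool))
    (hs : ∀ a ∈ s, ∀ N, ∃ z : LInftySum X, (∀ l < N, z l = 0) ∧ ε * ‖z‖ < |f (J a z)|) :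
    s.card * ε ≤ ‖f‖ := by
  obtain ⟨N, hN⟩ := exists_branch_disjoint s
  have h : ∀ a, ∃ z : LInftySum X, (∀ l < N, z l = 0) ∧ ‖z‖ ≤ 1 ∧ (a ∈ s → ε ≤ f (J a z)) := by
    intro a
    by_cases ha : a ∈ s
    · obtain ⟨z, hz, hfz⟩ := hs a ha N
      have hz0 : z ≠ 0 := by rintro rfl; simp at hfz
      have hz1 : 0 < ‖z‖ := norm_pos_iff.2 hz0
      -- Normalizes `z` and makes the value of `f` positive, so that the values add up without
      -- cancellation.
      let t : ℝ := SignType.sign (f (J a z)) * ‖z‖⁻¹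
      refine ⟨t • z, fun l hl => ?_, ?_, fun _ => ?_⟩
      · rw [lp.coeFn_smul, Pi.smul_apply, hz l hl, smul_zero]
      · rw [norm_smul]
        have : ‖t‖ ≤ ‖z‖⁻¹ := by
          simp only [t, norm_mul, norm_inv, norm_norm]
          refine mul_le_of_le_one_left (by positivity) ?_
          rcases lt_trichotomy (f (J a z)) 0 with h | h | h <;> simp [h]
        calc ‖t‖ * ‖z‖ ≤ ‖z‖⁻¹ * ‖z‖ := by gcongr
          _ = 1 := inv_mul_cancel₀ hz1.ne'
      · have : f (J a (t • z)) = |f (J a z)| / ‖z‖ := by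
          simp only [map_smul, smul_eq_mul, t]
          rw [← sign_mul_self (f (J a z))]; ring
        rw [this, le_div_iff₀ hz1]
        exact hfz.le
    · exact ⟨0, fun _ _ => rfl, by simp, fun h => absurd h ha⟩
  choose z hz hz1 hfz using h
  -- Beyond `N` the branches are disjoint and each `z a` vanishes before `N`, so at most one summand
  -- is nonzero in each component.
  have hnorm : ‖∑ a ∈ s, J a (z a)‖ ≤ 1 := by
    refine lp.norm_le_of_forall_le zero_le_one fun k => ?_
    rw [lp.coeFn_sum, Finset.sum_apply]
    by_cases hk : ∃ a ∈ s, J a (z a) k ≠ 0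
    · obtain ⟨a, ha, hak⟩ := hk
      obtain ⟨l, rfl⟩ : ∃ l, branch a l = k := by
        by_contra! h; exact hak (hJ2 a _ k h)
      rw [Finset.sum_eq_single a]
      · rw [hJ1]; exact (lp.norm_apply_le_norm (by simp) _ _).trans (hz1 a)
      · intro b hb hba
        by_cases h : ∃ n, branch b n = branch a l
        · obtain ⟨n, hn⟩ := h
          rw [← hn, hJ1]
          refine hz b n (not_le.1 fun h => ?_)
          exact hN a ha b hb hba.symm l n h hn.symm
        · exact hJ2 b _ _ (by simpa using h)
      · exact fun h => absurd ha h
    · push Not at hk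
      rw [Finset.sum_eq_zero hk]; simp
  calc (s.card : ℝ) * ε = ∑ a ∈ s, ε := by simp
    _ ≤ ∑ a ∈ s, f (J a (z a)) := Finset.sum_le_sum fun a ha => hfz a ha
    _ = f (∑ a ∈ s, J a (z a)) := by rw [map_sum]
    _ ≤ ‖f (∑ a ∈ s, J a (z a))‖ := le_abs_self _
    _ ≤ ‖f‖ * ‖∑ a ∈ s, J a (z a)‖ := f.le_opNorm _
    _ ≤ ‖f‖ := mul_le_of_le_one_right (norm_nonneg _) hnorm

/-- Non-normality is witnessed by some threshold `1 / (n + 1)`, and each threshold allows only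
finitely many branches. -/
theorem countable_not_normal {J : (ℕ → Bool) → LInftySum X →L[ℝ] LInftySum X}
    (hJ1 : ∀ a z k, J a z (branch a k) = z k)
    (hJ2 : ∀ a z k, (∀ l, branch a l ≠ k) → J a z k = 0)
    (f : StrongDual ℝ (LInftySum X)) : {a | ¬ IsNormal (f ∘L J a)}.Countable := by
  have h : {a | ¬ IsNormal (f ∘L J a)} ⊆ ⋃ n : ℕ, {a | ∀ N, ∃ z : LInftySum X,
      (∀ l < N, z l = 0) ∧ (1 / ((n : ℝ) + 1)) * ‖z‖ < |f (J a z)|} := by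
    intro a ha
    simp only [Set.mem_ofPred_eq, IsNormal] at ha
    push Not at ha
    obtain ⟨ε, hε, h⟩ := ha
    obtain ⟨n, hn⟩ := exists_nat_one_div_lt hε
    refine Set.mem_iUnion.2 ⟨n, fun N => ?_⟩
    obtain ⟨z, hz, hfz⟩ := h N
    exact ⟨z, hz, lt_of_le_of_lt (by gcongr) hfz⟩
  refine (Set.countable_iUnion fun n => Set.Finite.countable ?_).mono h
  by_contra hinf
  obtain ⟨K, hK⟩ := exists_nat_gt (‖f‖ * (n + 1))
  obtain ⟨s, hs, hcard⟩ := Set.Infinite.exists_subset_card_eq hinf K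
  have := card_le_of_not_normal hJ1 hJ2 f s fun a ha => hs ha
  rw [hcard, mul_one_div, div_le_iff₀ (by positivity)] at this
  linarith

instance : Uncountable (ℕ → Bool) := by
  rw [← Cardinal.aleph0_lt_mk_iff]
  simpa using Cardinal.cantor Cardinal.aleph0

/-- Countably many functionals on `ℓ^∞(X)` are simultaneously normal on some subsequence of the
components. -/
theorem exists_normal_subsequence {ι : Type*} [Countable ι]
    (f : ι → StrongDual ℝ (LInftySum X)) :
    ∃ (φ : ℕ → ℕ) (J : LInftySum X →L[ℝ] LInftySum X), φ.Injective ∧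
      (∀ z k, J z (φ k) = z k) ∧ (∀ z k, (∀ l, φ l ≠ k) → J z k = 0) ∧
      ∀ i, IsNormal (f i ∘L J) := by
  choose J _ hJ1 hJ2 using fun a => exists_extend (X := X) (branch_injective a)
  have h : (⋃ i, {a | ¬ IsNormal (f i ∘L J a)}).Countable :=
    Set.countable_iUnion fun i => countable_not_normal hJ1 hJ2 (f i)
  obtain ⟨a, ha⟩ : ∃ a, a ∉ ⋃ i, {a | ¬ IsNormal (f i ∘L J a)} := by
    by_contra! hall
    exact Set.not_countable_univ (h.mono fun a _ => hall a)
  refine ⟨branch a, J a, branch_injective a, hJ1 a, hJ2 a, fun i => ?_⟩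
  by_contra hi
  exact ha (Set.mem_iUnion.2 ⟨i, hi⟩)

end LInftySum

/-! ### The games: strategies, runs and Player I's choices -/

section Game

variable {X : Type*} [NormedAddCommGroup X] [NormedSpace ℝ X]

theorem playerTwoWinsArrayRep_of_isStrategicallyReproducible {e : SchauderBasis ℝ X} {C : ℝ}
    (h : IsStrategicallyReproducible e C) {ν : ℕ × ℕ ≃ ℕ}
    (hν : ∀ k i j, ν (k, i) < ν (k, j) ↔ i < j) {η : ℝ} (hη : 0 < η) :
    PlayerTwoWinsArrayRep ν (fun _ : ℕ => e) C η := by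
  obtain ⟨σ, hσ⟩ := h η hη
  have hle : ∀ n (i : ℕ), i ≤ (ν.symm n).2 → ν ((ν.symm n).1, i) ≤ n := fun n i hi => by
    conv_rhs => rw [← ν.apply_symm_apply n]
    rw [← not_lt]
    change ¬ ν ((ν.symm n).1, (ν.symm n).2) < _
    rw [hν]; omega
  have hlt : ∀ n (i : ℕ), i < (ν.symm n).2 → ν ((ν.symm n).1, i) < n := fun n i hi => by
    conv_rhs => rw [← ν.apply_symm_apply n]
    exact (hν _ _ _).2 hi
  -- Only the part of the record in the current row is passed to `σ`. Monotonicity of `ν` along rows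
  -- ensures that the earlier moves of that row are already known.
  let τ : RepStrategy X := fun c n p ε =>
    σ (fun i => c (ν ((ν.symm n).1, i))) (ν.symm n).2
      (fun i => p ⟨ν ((ν.symm n).1, i), by have := hle n i (by omega); omega⟩)
      (fun i => ε ⟨ν ((ν.symm n).1, i), hlt n i i.2⟩)
  have hτ : ∀ c p ε k j, τ.move c p ε (ν (k, j)) =
      σ.move (fun i => c (ν (k, i))) (fun i => p (ν (k, i))) (fun i => ε (ν (k, i))) j := by
    intro c p ε k j
    -- The pair is generalized so that it can be substituted in the dependent types `Fin (n + 1)`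
    -- and `Fin n`.
    have key : ∀ q : ℕ × ℕ, ν.symm (ν (k, j)) = q → τ.move c p ε (ν (k, j)) =
      σ.move (fun i => c (ν (q.1, i))) (fun i => p (ν (q.1, i))) (fun i => ε (ν (q.1, i))) q.2 := by
      rintro q rfl; rfl
    exact key (k, j) (ν.symm_apply_apply _)
  refine ⟨τ, fun c p ε => ?_⟩
  simp only [hτ]
  have hk := fun k => hσ (fun i => c (ν (k, i))) (fun i => p (ν (k, i))) (fun i => ε (ν (k, i)))
  exact ⟨fun k => (hk k).1, fun k => (hk k).2.1, fun k => (hk k).2.2.1,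
    fun k => (hk k).2.2.2.2, fun k => (hk k).2.2.2.1⟩

theorem RepStrategy.move_congr (σ : RepStrategy X) (c : ℕ → Fin 2) {p p' : ℕ → RepMoveOne X}
    {ε ε' : ℕ → ℕ → ℤˣ} {n : ℕ} (hp : ∀ m ≤ n, p m = p' m) (hε : ∀ m < n, ε m = ε' m) :
    σ.move c p ε n = σ.move c p' ε' n := by
  unfold RepStrategy.move
  congr 1
  · funext m; exact hp m (by omega)
  · funext m; exact hε m m.2

/-- The run of the game in which Player I answers the history of the game by the rules `F` and
`H`. -/
theorem RepStrategy.exists_run (σ : RepStrategy X) (c : ℕ → Fin 2)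
    (F : ℕ → (ℕ → RepMoveTwo) → (ℕ → ℕ → ℤˣ) → RepMoveOne X) (H : ℕ → RepMoveTwo → ℕ → ℤˣ)
    (hF : ∀ n m m' s s', (∀ i < n, m i = m' i ∧ s i = s' i) → F n m s = F n m' s') :
    ∃ (p : ℕ → RepMoveOne X) (ε : ℕ → ℕ → ℤˣ), ∀ n,
      p n = F n (σ.move c p ε) ε ∧ ε n = H n (σ.move c p ε n) := by
  -- A filler for the turns not yet played; `hF` makes its value irrelevant.
  let d : RepMoveOne X := F 0 (fun _ => ⟨0, ∅, 0, 0⟩) 1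
  let pre (n : ℕ) (h : ∀ m < n, RepMoveOne X × (ℕ → ℤˣ)) : ℕ → RepMoveOne X × (ℕ → ℤˣ) :=
    fun m => if hm : m < n then h m hm else (d, 1)
  let one (n : ℕ) (h : ∀ m < n, RepMoveOne X × (ℕ → ℤˣ)) : RepMoveOne X :=
    F n (σ.move c (fun m => (pre n h m).1) fun m => (pre n h m).2) fun m => (pre n h m).2
  -- The update at `n` is needed because Player II's move in turn `n` already sees Player I's
  -- first-step move of that turn.
  let step (n : ℕ) (h : ∀ m < n, RepMoveOne X × (ℕ → ℤˣ)) : RepMoveOne X × (ℕ → ℤˣ) :=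
    (one n h, H n (σ.move c (Function.update (fun m => (pre n h m).1) n (one n h))
      (fun m => (pre n h m).2) n))
  let u : ℕ → RepMoveOne X × (ℕ → ℤˣ) := fun n => Nat.strongRec step n
  have hu : ∀ n, u n = step n fun m _ => u m := fun n => by
    simp only [u]; rw [Nat.strongRec_eq]
  have hpre : ∀ n m, m < n → pre n (fun m _ => u m) m = u m := fun n m hm => dif_pos hm
  have hp : ∀ n, (u n).1 = F n (σ.move c (fun m => (u m).1) fun m => (u m).2) fun m => (u m).2 := by
    intro n
    rw [hu n]
    refine hF n _ _ _ _ fun i hi => ⟨?_, by rw [hpre n i hi]⟩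
    exact σ.move_congr c (fun m hm => by rw [hpre n m (by omega)])
      fun m hm => by rw [hpre n m (by omega)]
  refine ⟨fun n => (u n).1, fun n => (u n).2, fun n => ⟨hp n, ?_⟩⟩
  have h1 : (u n).1 = one n fun m _ => u m := by rw [hu n]
  have h2 : (u n).2 = H n (σ.move c (Function.update
      (fun m => (pre n (fun m _ => u m) m).1) n (one n fun m _ => u m))
      (fun m => (pre n (fun m _ => u m) m).2) n) := by rw [hu n]
  refine h2.trans ?_
  congr 1
  refine σ.move_congr c (fun m hm => ?_) fun m hm => by rw [hpre n m hm]
  rcases hm.lt_or_eq with hm | rfl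
  · rw [Function.update_of_ne hm.ne, hpre n m hm]
  · rw [Function.update_self, h1]

/-- Averaging over signs: some choice of signs makes the quadratic form at least its trace. -/
theorem exists_signs_le (s : Finset ℕ) (a : ℕ → ℕ → ℝ) :
    ∃ ε : ℕ → ℤˣ, ∑ i ∈ s, a i i ≤
      ∑ i ∈ s, ∑ j ∈ s, (((ε i : ℤ) : ℝ) * ((ε j : ℤ) : ℝ)) * a i j := by
  classical
  induction s using Finset.induction_on with
  | empty => exact ⟨1, by simp⟩
  | insert k s hk ih =>
    obtain ⟨ε, hε⟩ := ih
    -- The cross terms of the new index `k` sum to `t * b`, where `t` is its sign; choosing `t` to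
    -- make this nonnegative is enough.
    let b : ℝ := ∑ i ∈ s, ((ε i : ℤ) : ℝ) * (a i k + a k i)
    obtain ⟨t, ht⟩ : ∃ t : ℤˣ, 0 ≤ ((t : ℤ) : ℝ) * b := by
      rcases le_total 0 b with h | h
      · exact ⟨1, by simpa using h⟩
      · exact ⟨-1, by simpa using h⟩
    refine ⟨Function.update ε k t, ?_⟩
    have hne : ∀ i ∈ s, Function.update ε k t i = ε i := fun i hi =>
      Function.update_of_ne (by rintro rfl; exact hk hi) _ _
    have htt : ((t : ℤ) : ℝ) * ((t : ℤ) : ℝ) = 1 := by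
      rcases Int.units_eq_one_or t with rfl | rfl <;> simp
    rw [Finset.sum_insert hk, Finset.sum_insert hk, Finset.sum_insert hk]
    simp only [Function.update_self, htt, one_mul]
    have h1 : ∑ j ∈ s, (((t : ℤ) : ℝ) * ((Function.update ε k t j : ℤ) : ℝ)) * a k j =
        ((t : ℤ) : ℝ) * ∑ i ∈ s, ((ε i : ℤ) : ℝ) * a k i := by
      rw [Finset.mul_sum]
      exact Finset.sum_congr rfl fun j hj => by rw [hne j hj]; ring
    have h2 : ∑ i ∈ s, ∑ j ∈ insert k s, (((Function.update ε k t i : ℤ) : ℝ) *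
        ((Function.update ε k t j : ℤ) : ℝ)) * a i j =
        ((t : ℤ) : ℝ) * (∑ i ∈ s, ((ε i : ℤ) : ℝ) * a i k) +
          ∑ i ∈ s, ∑ j ∈ s, (((ε i : ℤ) : ℝ) * ((ε j : ℤ) : ℝ)) * a i j := by
      rw [Finset.mul_sum, ← Finset.sum_add_distrib]
      refine Finset.sum_congr rfl fun i hi => ?_
      rw [Finset.sum_insert hk, Function.update_self, hne i hi]
      congr 1
      · ring
      · exact Finset.sum_congr rfl fun j hj => by rw [hne j hj]
    have h3 : b = ∑ i ∈ s, ((ε i : ℤ) : ℝ) * a i k + ∑ i ∈ s, ((ε i : ℤ) : ℝ) * a k i := by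
      rw [← Finset.sum_add_distrib]
      exact Finset.sum_congr rfl fun i _ => by ring
    rw [h1, h2]
    rw [h3, mul_add] at ht
    linarith

/-- If the diagonal entries on the chosen side of the partition have constant sign, then Player I
can choose signs which keep the diagonal of `T` large. -/
theorem exists_signs_diagonal (e : SchauderBasis ℝ X) (T : X →L[ℝ] X) {δ η : ℝ} (hδ : 0 ≤ δ)
    (hT : ∀ i, δ ≤ |e.coord i (T (e i))|) (m : RepMoveTwo)
    (hm : m.Legal η fun i => if 0 ≤ e.coord i (T (e i)) then 0 else 1) :
    ∃ ε : ℕ → ℤˣ, δ * (1 - η) ≤ |m.covec e ε (T (m.vec e ε))| := by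
  obtain ⟨hside, hpos, hlow, -⟩ := hm
  -- All diagonal entries on the chosen side share one sign `t`, so the trace involves no
  -- cancellation.
  obtain ⟨t, ht⟩ : ∃ t : ℤˣ, ∀ i ∈ m.E,
      ((t : ℤ) : ℝ) * e.coord i (T (e i)) = |e.coord i (T (e i))| := by
    by_cases h0 : m.side = 0
    · refine ⟨1, fun i hi => ?_⟩
      have := hside i hi
      simp only [h0] at this
      have h : 0 ≤ e.coord i (T (e i)) := by
        by_contra h; simp [h] at this
      simp [abs_of_nonneg h]
    · refine ⟨-1, fun i hi => ?_⟩
      have := hside i hi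
      have h : ¬ 0 ≤ e.coord i (T (e i)) := by
        intro h; simp only [h, if_true] at this; exact h0 this.symm
      simp [abs_of_neg (not_le.1 h)]
  obtain ⟨ε, hε⟩ := exists_signs_le m.E fun i j =>
    ((t : ℤ) : ℝ) * (m.mu i * m.lam j * e.coord i (T (e j)))
  refine ⟨ε, ?_⟩
  have h1 : ∑ i ∈ m.E, ∑ j ∈ m.E, (((ε i : ℤ) : ℝ) * ((ε j : ℤ) : ℝ)) *
      (((t : ℤ) : ℝ) * (m.mu i * m.lam j * e.coord i (T (e j)))) =
      ((t : ℤ) : ℝ) * m.covec e ε (T (m.vec e ε)) := by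
    simp only [RepMoveTwo.covec, RepMoveTwo.vec, map_sum, map_smul, sum_apply,
      smul_apply, smul_eq_mul, Finset.mul_sum]
    rw [Finset.sum_comm]
    refine Finset.sum_congr rfl fun i _ => Finset.sum_congr rfl fun j _ => by ring
  have h2 : δ * (1 - η) ≤ ∑ i ∈ m.E, ((t : ℤ) : ℝ) * (m.mu i * m.lam i * e.coord i (T (e i))) := by
    calc δ * (1 - η) ≤ δ * ∑ i ∈ m.E, m.lam i * m.mu i := by gcongr
      _ = ∑ i ∈ m.E, (m.lam i * m.mu i) * δ := by
        rw [Finset.mul_sum]; exact Finset.sum_congr rfl fun i _ => by ring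
      _ ≤ ∑ i ∈ m.E, (m.lam i * m.mu i) * |e.coord i (T (e i))| :=
        Finset.sum_le_sum fun i hi => mul_le_mul_of_nonneg_left (hT i)
          (mul_nonneg (hpos i hi).1 (hpos i hi).2)
      _ = _ := Finset.sum_congr rfl fun i hi => by rw [← ht i hi]; ring
  rw [h1] at hε
  refine (h2.trans hε).trans ((le_abs_self _).trans_eq ?_)
  rw [abs_mul]
  rcases Int.units_eq_one_or t with rfl | rfl <;> simp

theorem abs_apply_le_of_infDist_lt {V : Type*} [NormedAddCommGroup V] [NormedSpace ℝ V]
    {W : Submodule ℝ V} {x : V} {r : ℝ} (h : Metric.infDist x (W : Set V) < r)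
    (f : StrongDual ℝ V) (hf : ∀ w ∈ W, f w = 0) : |f x| ≤ ‖f‖ * r := by
  obtain ⟨w, hw, hxw⟩ := (Metric.infDist_lt_iff ⟨0, W.zero_mem⟩).1 h
  have : f x = f (x - w) := by rw [map_sub, hf w hw, sub_zero]
  rw [this, ← Real.norm_eq_abs]
  refine (f.le_opNorm _).trans ?_
  gcongr
  rw [← dist_eq_norm]; exact hxw.le

/-- The move of Player I given by the common kernels of finitely many functionals and of finitely
many vectors. -/
def RepMoveOne.ofKernels {ι κ : Type*} [Finite ι] [Finite κ] (r : ℝ) (hr : 0 < r)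
    (f : ι → StrongDual ℝ X) (v : κ → X) : RepMoveOne X where
  tol := r
  tol_pos := hr
  W := LinearMap.ker (LinearMap.pi fun i => (f i).toLinearMap)
  finite_codim_W := (LinearMap.quotKerEquivRange _).symm.finiteDimensional
  G := LinearMap.ker (LinearMap.pi fun i =>
    ((ContinuousLinearMap.apply ℝ ℝ (v i)).toLinearMap : StrongDual ℝ X →ₗ[ℝ] ℝ))
  finite_codim_G := (LinearMap.quotKerEquivRange _).symm.finiteDimensional
  weakStar_closed_G := by
    have : {g : WeakDual ℝ X | WeakDual.toStrongDual g ∈ LinearMap.ker (LinearMap.pi fun i =>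
        ((ContinuousLinearMap.apply ℝ ℝ (v i)).toLinearMap : StrongDual ℝ X →ₗ[ℝ] ℝ))} =
        ⋂ i, {g : WeakDual ℝ X | g (v i) = 0} := by
      ext g
      simp only [Set.mem_ofPred_eq, LinearMap.mem_ker, Set.mem_iInter, funext_iff]
      rfl
    rw [this]
    exact isClosed_iInter fun i => isClosed_eq (WeakDual.eval_continuous (v i)) continuous_const

theorem RepMoveOne.mem_ofKernels_W {ι κ : Type*} [Finite ι] [Finite κ] {r : ℝ} {hr : 0 < r}
    {f : ι → StrongDual ℝ X} {v : κ → X} {x : X} (hx : x ∈ (ofKernels r hr f v).W) (i : ι) :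
    f i x = 0 :=
  congrFun (LinearMap.mem_ker.1 hx) i

theorem RepMoveOne.mem_ofKernels_G {ι κ : Type*} [Finite ι] [Finite κ] {r : ℝ} {hr : 0 < r}
    {f : ι → StrongDual ℝ X} {v : κ → X} {g : StrongDual ℝ X} (hg : g ∈ (ofKernels r hr f v).G)
    (i : κ) : g (v i) = 0 :=
  congrFun (LinearMap.mem_ker.1 hg) i

/-- Playing the array game against the blocks `T k l` of an operator matrix, Player I obtains block
sequences for which the matrix is almost diagonal, with large diagonal. -/
theorem PlayerTwoWinsArrayRep.exists_almost_diagonal {ν : ℕ × ℕ ≃ ℕ} {e : SchauderBasis ℝ X}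
    {C η : ℝ} (h : PlayerTwoWinsArrayRep ν (fun _ : ℕ => e) C η) (T : ℕ → ℕ → X →L[ℝ] X) {δ : ℝ}
    (hδ : 0 ≤ δ) (hT : ∀ k i, δ ≤ |e.coord i (T k k (e i))|) {r : ℕ → ℝ} (hr : ∀ n, 0 < r n) :
    ∃ (x : ℕ × ℕ → X) (f : ℕ × ℕ → StrongDual ℝ X),
      (∀ k, ImpartiallyEquivalent (C + η) (fun j => x (k, j)) fun j => e j) ∧
      (∀ k, ImpartiallyEquivalent (C + η) (fun j => f (k, j)) e.coord) ∧
      (∀ q, f q ∈ Submodule.span ℝ (Set.range e.coord)) ∧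
      (∀ q, δ * (1 - η) ≤ |f q (T q.1 q.1 (x q))|) ∧
      (∀ q s, ν s < ν q → |f s (T s.1 q.1 (x q))| ≤ ‖f s‖ * ‖T s.1 q.1‖ * r (ν q)) ∧
      (∀ q s, ν s < ν q → |f q (T q.1 s.1 (x s))| ≤ ‖T q.1 s.1‖ * ‖x s‖ * r (ν q)) ∧
      ∀ q i, i < ν q → |f q (e i)| ≤ ‖e i‖ * r (ν q) := by
  obtain ⟨σ, hσ⟩ := h
  let ρ : ℕ → ℕ := fun n => (ν.symm n).1
  -- The kernels control the matrix entries pairing turn `n` with each earlier turn, in both orders.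
  -- The extra vectors `e i` make the later functionals small on each basis vector, as required by
  -- `exists_clm_of_functionals`.
  let F : ℕ → (ℕ → RepMoveTwo) → (ℕ → ℕ → ℤˣ) → RepMoveOne X := fun n m s =>
    RepMoveOne.ofKernels (r n) (hr n)
      (fun i : Fin n => (m i).covec e (s i) ∘L T (ρ i) (ρ n))
      (Sum.elim (fun i : Fin n => T (ρ n) (ρ i) ((m i).vec e (s i))) fun i : Fin n => e i)
  let c : ℕ → Fin 2 := fun n =>
    if 0 ≤ e.coord (ν.symm n).2 (T (ρ n) (ρ n) (e (ν.symm n).2)) then 0 else 1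
  have hsgn : ∀ (n : ℕ) (m : RepMoveTwo), ∃ ε : ℕ → ℤˣ,
      m.Legal η (fun i => if 0 ≤ e.coord i (T (ρ n) (ρ n) (e i)) then 0 else 1) →
      δ * (1 - η) ≤ |m.covec e ε (T (ρ n) (ρ n) (m.vec e ε))| := by
    intro n m
    by_cases hm : m.Legal η (fun i => if 0 ≤ e.coord i (T (ρ n) (ρ n) (e i)) then 0 else 1)
    · obtain ⟨ε, hε⟩ := exists_signs_diagonal e (T (ρ n) (ρ n)) hδ (hT _) m hm
      exact ⟨ε, fun _ => hε⟩
    · exact ⟨1, fun h => absurd h hm⟩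
  choose H hH using hsgn
  obtain ⟨p, ε, hpε⟩ := σ.exists_run c F H (by
    intro n m m' s s' h
    have h1 : (fun i : Fin n => (m i).covec e (s i) ∘L T (ρ i) (ρ n)) =
        fun i : Fin n => (m' i).covec e (s' i) ∘L T (ρ i) (ρ n) := by
      funext i; rw [(h i i.2).1, (h i i.2).2]
    have h2 : (fun i : Fin n => T (ρ n) (ρ i) ((m i).vec e (s i))) =
        fun i : Fin n => T (ρ n) (ρ i) ((m' i).vec e (s' i)) := by
      funext i; rw [(h i i.2).1, (h i i.2).2]
    simp only [F]
    rw [h1, h2])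
  obtain ⟨hleg, hx, hf, hG, hW⟩ := hσ c p ε
  set x : ℕ → X := fun n => (σ.move c p ε n).vec e (ε n) with hxdef
  set f : ℕ → StrongDual ℝ X := fun n => (σ.move c p ε n).covec e (ε n) with hfdef
  have hp : ∀ n, p n = RepMoveOne.ofKernels (r n) (hr n) (fun i : Fin n => f i ∘L T (ρ i) (ρ n))
      (Sum.elim (fun i : Fin n => T (ρ n) (ρ i) (x i)) fun i : Fin n => e i) := fun n => (hpε n).1
  have hρ : ∀ q, ρ (ν q) = q.1 := fun q => by simp [ρ]
  have hW' : ∀ q, Metric.infDist (x (ν q)) ((p (ν q)).W : Set X) < r (ν q) := fun q => by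
    have := hW q.1 q.2
    rwa [show (p (ν (q.1, q.2))).tol = r (ν q) by rw [hp]; rfl] at this
  have hG' : ∀ q, Metric.infDist (f (ν q)) ((p (ν q)).G : Set (StrongDual ℝ X)) < r (ν q) :=
    fun q => by
      have := hG q.1 q.2
      rwa [show (p (ν (q.1, q.2))).tol = r (ν q) by rw [hp]; rfl] at this
  have hker : ∀ q v, (∀ g ∈ (p (ν q)).G, g v = 0) → |f (ν q) v| ≤ ‖v‖ * r (ν q) := by
    intro q v hv
    refine (abs_apply_le_of_infDist_lt (hG' q) (ContinuousLinearMap.apply ℝ ℝ v) hv).trans ?_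
    have : ‖(ContinuousLinearMap.apply ℝ ℝ v : StrongDual ℝ X →L[ℝ] ℝ)‖ ≤ ‖v‖ :=
      ContinuousLinearMap.opNorm_le_bound _ (norm_nonneg _) fun g => by
        rw [mul_comm]; exact g.le_opNorm v
    exact mul_le_mul_of_nonneg_right this (hr _).le
  refine ⟨fun q => x (ν q), fun q => f (ν q), hx, hf, fun q => ?_, fun q => ?_, fun q s hs => ?_,
    fun q s hs => ?_, fun q i hi => ?_⟩
  · exact Submodule.sum_mem _ fun i _ => Submodule.smul_mem _ _ (Submodule.subset_span ⟨i, rfl⟩)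
  · have h1 := hleg q.1 q.2
    have h2 := hH (ν q) (σ.move c p ε (ν q)) (by
      convert h1 using 2 with i
      simp [c, ρ])
    rw [← (hpε (ν q)).2, hρ] at h2
    exact h2
  · refine (abs_apply_le_of_infDist_lt (hW' q) (f (ν s) ∘L T s.1 q.1) fun w hw => ?_).trans ?_
    · rw [hp] at hw
      have := RepMoveOne.mem_ofKernels_W hw ⟨ν s, hs⟩
      simpa only [hρ] using this
    · exact mul_le_mul_of_nonneg_right (ContinuousLinearMap.opNorm_comp_le _ _) (hr _).le
  · refine (hker q _ fun g hg => ?_).trans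
      (mul_le_mul_of_nonneg_right (ContinuousLinearMap.le_opNorm _ _) (hr _).le)
    rw [hp] at hg
    have := RepMoveOne.mem_ofKernels_G hg (Sum.inl ⟨ν s, hs⟩)
    simpa only [hρ, Sum.elim_inl] using this
  · refine hker q _ fun g hg => ?_
    rw [hp] at hg
    exact RepMoveOne.mem_ofKernels_G hg (Sum.inr ⟨i, hi⟩)

end Game

/-! ### Perturbation and factorization -/

section Factorization

variable {X : Type*} [NormedAddCommGroup X] [NormedSpace ℝ X]

/-- Only the product of the norms is controlled; rescaling bounds each factor separately, so that
infinitely many rows can be assembled into one operator. -/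
theorem IdentityFactorsThroughWith.exists_normalized {Q : ℝ} {T : X →L[ℝ] X} {x : X} (hx : x ≠ 0)
    (h : IdentityFactorsThroughWith Q T) :
    ∃ A B : X →L[ℝ] X, ‖A‖ ≤ Q ∧ ‖B‖ ≤ 1 ∧ ∀ x, A (T (B x)) = x := by
  obtain ⟨A, B, hAB, h⟩ := h
  have h1 : ∀ x, A (T (B x)) = x := fun x => congrArg (fun L : X →L[ℝ] X => L x) h
  have hB : 0 < ‖B‖ := by
    rw [norm_pos_iff]; rintro rfl
    exact hx (by rw [← h1 x]; simp)
  refine ⟨‖B‖ • A, ‖B‖⁻¹ • B, ?_, ?_, fun x => ?_⟩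
  · rw [norm_smul, norm_norm, mul_comm]; exact hAB
  · rw [norm_smul, norm_inv, norm_norm, inv_mul_cancel₀ hB.ne']
  · simp [h1, smul_smul, hB.ne']

theorem isUnit_id_add_of_norm_lt_one {E : Type*} [NormedAddCommGroup E] [NormedSpace ℝ E]
    [CompleteSpace E] {R : E →L[ℝ] E} (hR : ‖R‖ < 1) :
    ∃ V : E →L[ℝ] E, V ∘L (ContinuousLinearMap.id ℝ E + R) = ContinuousLinearMap.id ℝ E := by
  have hu : IsUnit (1 - -R : E →L[ℝ] E) := isUnit_one_sub_of_norm_lt_one (by rwa [norm_neg])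
  obtain ⟨V, hV⟩ := hu.exists_left_inv
  rw [sub_neg_eq_add] at hV
  exact ⟨V, hV⟩

variable (e : SchauderBasis ℝ X)

theorem arrayCoord_apply (q : ℕ × ℕ) (z : LInftySum X) :
    arrayCoord e q.1 q.2 z = e.coord q.2 (z q.1) := rfl

theorem arrayVec_eq (q : ℕ × ℕ) : arrayVec e q.1 q.2 = LInftySum.incl q.1 (e q.2) := rfl

theorem arrayCoord_arrayVec_self (q : ℕ × ℕ) :
    arrayCoord e q.1 q.2 (arrayVec e q.1 q.2) = 1 := by
  rw [arrayCoord_apply, arrayVec_eq, LInftySum.incl_apply_self, e.coord_self]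

theorem arrayCoord_arrayVec_of_ne {q s : ℕ × ℕ} (h : q ≠ s) :
    arrayCoord e q.1 q.2 (arrayVec e s.1 s.2) = 0 := by
  rw [arrayCoord_apply, arrayVec_eq]
  by_cases h1 : q.1 = s.1
  · rw [h1, LInftySum.incl_apply_self]
    exact e.coord_of_ne fun h2 => h (Prod.ext h1 h2)
  · rw [LInftySum.incl_apply_ne h1, map_zero]

theorem isNormal_arrayCoord (q : ℕ × ℕ) : LInftySum.IsNormal (arrayCoord e q.1 q.2) :=
  LInftySum.isNormal_comp_eval (e.coord q.2) q.1

/-- Normality reduces equality to single components, where the basis decides it. -/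
theorem LInftySum.IsNormal.ext_arrayVec {f g : StrongDual ℝ (LInftySum X)}
    (hf : IsNormal f) (hg : IsNormal g)
    (h : ∀ s : ℕ × ℕ, f (arrayVec e s.1 s.2) = g (arrayVec e s.1 s.2)) : f = g := by
  refine sub_eq_zero.1 ((hf.sub hg).eq_zero fun l x => ?_)
  have : (f - g) ∘L incl l = 0 := e.clm_ext fun i => by
    have := h (l, i)
    rw [arrayVec_eq] at this
    simp [this]
  exact congrArg (fun L : X →L[ℝ] ℝ => L x) this

variable {e}

/-- An absolutely summable matrix defines a small operator on `ℓ^∞(X)`, all of whose coordinates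
are normal. -/
theorem exists_clm_of_summable_matrix [CompleteSpace X] (he : ∀ j, ‖e j‖ = 1) {κ : ℝ}
    (hκ : ∀ n, ‖e.proj n‖ ≤ κ) {a : ℕ × ℕ → ℕ × ℕ → ℝ} {w : ℕ × ℕ → ℝ} {W : ℝ} (hw : HasSum w W)
    (hw0 : ∀ q, 0 ≤ w q) {t : ℝ} (ha : ∀ q s, |a q s| ≤ t * (w q * w s)) :
    ∃ N : LInftySum X →L[ℝ] LInftySum X, ‖N‖ ≤ t * (W * W) * (2 * κ) ∧
      (∀ q : ℕ × ℕ, LInftySum.IsNormal (arrayCoord e q.1 q.2 ∘L N)) ∧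
      ∀ q s : ℕ × ℕ, arrayCoord e q.1 q.2 (N (arrayVec e s.1 s.2)) = a q s := by
  have hκ0 : 0 ≤ κ := (norm_nonneg _).trans (hκ 0)
  -- One rank-one operator per matrix entry; the series converges absolutely in operator norm.
  let G : (ℕ × ℕ) × (ℕ × ℕ) → LInftySum X →L[ℝ] LInftySum X := fun u =>
    a u.1 u.2 • (arrayCoord e u.2.1 u.2.2).smulRight (arrayVec e u.1.1 u.1.2)
  have hG : ∀ u, ‖G u‖ ≤ t * (w u.1 * w u.2) * (2 * κ) := by
    intro u
    rw [norm_smul, ContinuousLinearMap.norm_smulRight_apply, arrayVec_eq,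
      LInftySum.norm_incl_apply, he, mul_one]
    refine mul_le_mul (ha _ _) ?_ (norm_nonneg _) ((abs_nonneg _).trans (ha _ _))
    calc ‖arrayCoord e u.2.1 u.2.2‖ ≤ ‖e.coord u.2.2‖ * ‖lp.evalCLM ℝ (fun _ : ℕ => X) ⊤ u.2.1‖ :=
          ContinuousLinearMap.opNorm_comp_le _ _
      _ ≤ (2 * κ) * 1 := mul_le_mul (e.norm_coord_le he hκ _) (LInftySum.norm_evalCLM_le _)
          (norm_nonneg _) (by positivity)
      _ = 2 * κ := mul_one _
  have hb : HasSum (fun u : (ℕ × ℕ) × (ℕ × ℕ) => t * (w u.1 * w u.2) * (2 * κ))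
      (t * (W * W) * (2 * κ)) := by
    refine (HasSum.mul_left _ ?_).mul_right _
    exact hw.mul hw (hw.summable.mul_of_nonneg hw.summable hw0 hw0)
  have hGs : Summable G := Summable.of_norm_bounded hb.summable hG
  obtain ⟨N, hN⟩ := hGs
  refine ⟨N, ?_, fun q => ?_, fun q s => ?_⟩
  · rw [← hN.tsum_eq]; exact tsum_of_norm_bounded hb hG
  · have h1 := hN.mapL (ContinuousLinearMap.compL ℝ (LInftySum X) (LInftySum X) ℝ
      (arrayCoord e q.1 q.2))
    refine LInftySum.isClosed_normal.mem_of_tendsto h1 (Eventually.of_forall fun S => ?_)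
    refine Submodule.sum_mem (LInftySum.normalSubmodule X) fun u _ => ?_
    have : (ContinuousLinearMap.compL ℝ (LInftySum X) (LInftySum X) ℝ (arrayCoord e q.1 q.2)) (G u)
        = (a u.1 u.2 * arrayCoord e q.1 q.2 (arrayVec e u.1.1 u.1.2)) •
          arrayCoord e u.2.1 u.2.2 := by
      ext z
      simp [G]
      ring
    rw [this]
    exact (isNormal_arrayCoord e u.2).smul _
  · have h1 := hN.mapL (arrayCoord e q.1 q.2 ∘L
      ContinuousLinearMap.apply ℝ (LInftySum X) (arrayVec e s.1 s.2))
    have h2 : ∀ u, (arrayCoord e q.1 q.2 ∘L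
        ContinuousLinearMap.apply ℝ (LInftySum X) (arrayVec e s.1 s.2)) (G u) =
        a u.1 u.2 * (arrayCoord e u.2.1 u.2.2 (arrayVec e s.1 s.2) *
          arrayCoord e q.1 q.2 (arrayVec e u.1.1 u.1.2)) := fun u => by simp [G]
    refine h1.unique ?_
    have h3 := hasSum_single (f := fun u => (arrayCoord e q.1 q.2 ∘L
        ContinuousLinearMap.apply ℝ (LInftySum X) (arrayVec e s.1 s.2)) (G u)) (q, s) (by
      intro u hu
      rw [h2]
      by_cases hq : q = u.1
      · have hs : u.2 ≠ s := fun hs => hu (Prod.ext hq.symm hs)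
        rw [arrayCoord_arrayVec_of_ne e hs]; simp
      · rw [arrayCoord_arrayVec_of_ne e hq]; simp)
    simpa only [h2, arrayCoord_arrayVec_self, mul_one] using h3

/-- An operator on `ℓ^∞(X)` with diagonal matrix bounded away from zero admits a factorization of
the identity with a norm bound which depends on the lower bound only. -/
theorem HasDiagonalFactorizationProperty.exists_factors {K : ℝ → ℝ}
    (h : HasDiagonalFactorizationProperty e K) (he : ∀ j, ‖e j‖ = 1)
    {D : LInftySum X →L[ℝ] LInftySum X} {d : ℕ × ℕ → ℝ} {δ : ℝ} (hδ : 0 < δ)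
    (hd : ∀ q, δ ≤ |d q|)
    (hD : ∀ q : ℕ × ℕ, arrayCoord e q.1 q.2 ∘L D = d q • arrayCoord e q.1 q.2) :
    ∃ A B : LInftySum X →L[ℝ] LInftySum X, ‖A‖ ≤ K δ + 1 ∧ ‖B‖ ≤ 1 ∧ ∀ z, A (D (B z)) = z := by
  have hD' : ∀ k j z, e.coord j (D z k) = d (k, j) * e.coord j (z k) := fun k j z =>
    congrArg (fun L : LInftySum X →L[ℝ] ℝ => L z) (hD (k, j))
  let Dk : ℕ → X →L[ℝ] X := fun k =>
    lp.evalCLM ℝ (fun _ : ℕ => X) ⊤ k ∘L D ∘L LInftySum.incl k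
  have hDk : ∀ k j x, e.coord j (Dk k x) = d (k, j) * e.coord j x := by
    intro k j x
    have := hD' k j (LInftySum.incl k x)
    rw [LInftySum.incl_apply_self] at this
    exact this
  -- Each coordinate of `D z` depends only on the same coordinate of `z`, hence the rows decouple.
  have hrow : ∀ z k, D z k = Dk k (z k) := fun z k =>
    e.eq_of_coord fun j => by rw [hD', hDk]
  have hfac : ∀ k, ∃ A B : X →L[ℝ] X, ‖A‖ ≤ K δ + 1 ∧ ‖B‖ ≤ 1 ∧ ∀ x, A (Dk k (B x)) = x := by
    intro k
    have hx : e 0 ≠ 0 := by rw [← norm_pos_iff, he]; exact one_pos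
    refine (h δ hδ (Dk k) (fun m j hmj => ?_) (le_ciInf fun j => ?_) 1 one_pos).exists_normalized hx
    · rw [hDk, e.coord_of_ne hmj, mul_zero]
    · rw [hDk, e.coord_self, mul_one]; exact hd _
  choose A B hA hB hAB using hfac
  obtain ⟨A', hA', hA''⟩ := LInftySum.exists_clm_of_diagonal A hA
  obtain ⟨B', hB', hB''⟩ := LInftySum.exists_clm_of_diagonal B hB
  refine ⟨A', B', hA', hB', fun z => ?_⟩
  ext k
  rw [hA'', hrow, hB'', hAB]

/-- The factorization theorem for operators all of whose coordinates are normal. -/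
theorem identityFactorsThrough_of_isNormal [CompleteSpace X] (he : ∀ j, ‖e j‖ = 1) {C : ℝ}
    (hrep : IsStrategicallyReproducible e C)
    {K : ℝ → ℝ} (hK : ∀ δ, 0 < δ → 0 < K δ) (hdiag : HasDiagonalFactorizationProperty e K)
    {T : LInftySum X →L[ℝ] LInftySum X}
    (hT : ∀ q : ℕ × ℕ, LInftySum.IsNormal (arrayCoord e q.1 q.2 ∘L T)) {δ : ℝ} (hδ : 0 < δ)
    (hTd : ∀ q : ℕ × ℕ, δ ≤ |arrayCoord e q.1 q.2 (T (arrayVec e q.1 q.2))|) :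
    IdentityFactorsThrough T := by
  obtain ⟨κ, hκ1, hκ⟩ := e.exists_one_le_norm_proj_le
  have hκ0 : 0 < κ := by linarith
  set Q : ℝ := K (δ / 2) + 1 with hQ
  have hQ0 : 0 < Q := by have := hK (δ / 2) (by positivity); positivity
  -- Bounds both `‖f q‖ * ‖T‖` and `‖T‖ * ‖x s‖`, with the game played at `η = 1 / 2`.
  set M : ℝ := ‖T‖ * (√(C + 1 / 2) * (2 * κ)) with hM
  have hM0 : 0 ≤ M := by positivity
  -- Chosen so that the final error bound `8 * κ * Q * M * θ` is below one; the summand `1` covers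
  -- `M = 0`.
  set θ : ℝ := 1 / (8 * κ * Q * M + 1) with hθ
  have hθ0 : 0 < θ := by positivity
  let ν : ℕ × ℕ ≃ ℕ := Nat.pairEquiv
  have hν : ∀ k i j, ν (k, i) < ν (k, j) ↔ i < j := fun k i j =>
    (show StrictMono fun i => Nat.pair k i from fun _ _ h => Nat.pair_lt_pair_right k h).lt_iff_lt
  have hνle : ∀ k j, j ≤ ν (k, j) := fun k j => Nat.right_le_pair k j
  let τ : ℕ → ℕ → X →L[ℝ] X := fun k l =>
    lp.evalCLM ℝ (fun _ : ℕ => X) ⊤ k ∘L T ∘L LInftySum.incl l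
  have hτ : ∀ k l, ‖τ k l‖ ≤ ‖T‖ := fun k l =>
    ContinuousLinearMap.opNorm_le_bound _ (norm_nonneg _) fun x =>
      (lp.norm_apply_le_norm (by simp) _ k).trans
        ((T.le_opNorm _).trans_eq (congrArg _ (LInftySum.norm_incl_apply l x)))
  obtain ⟨x, f, hx, hf, hfspan, hfx, hoff1, hoff2, hfe⟩ :=
    (playerTwoWinsArrayRep_of_isStrategicallyReproducible hrep hν
      (by norm_num : (0 : ℝ) < 1 / 2)).exists_almost_diagonal τ hδ.le (fun k i => hTd (k, i))
      (r := fun n => θ * (1 / 4) ^ n) fun n => by positivity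
  have hxn : ∀ q, ‖x q‖ ≤ √(C + 1 / 2) * (2 * κ) := fun q => by
    refine ((hx q.1).norm_le q.2).trans ?_
    rw [he]; gcongr; linarith
  have hfn : ∀ q, ‖f q‖ ≤ √(C + 1 / 2) * (2 * κ) := fun q => by
    refine ((hf q.1).norm_le q.2).trans ?_
    gcongr
    exact e.norm_coord_le he hκ _
  choose B hB hBe using fun k => e.exists_clm_of_vectors hκ (hx k)
  choose A hA hAf using fun k => e.exists_clm_of_functionals he hκ (hf k) (by
    intro i
    have hg : Summable fun j : ℕ => θ * (1 / 4 : ℝ) ^ j :=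
      (summable_geometric_of_lt_one (by norm_num) (by norm_num)).mul_left θ
    refine Summable.of_norm_bounded_eventually_nat hg ?_
    filter_upwards [eventually_gt_atTop i] with j hj
    rw [norm_abs_eq_norm, Real.norm_eq_abs]
    refine (hfe (k, j) i (hj.trans_le (hνle k j))).trans ?_
    rw [he, one_mul]
    exact mul_le_mul_of_nonneg_left
      (pow_le_pow_of_le_one (by norm_num) (by norm_num) (hνle k j)) hθ0.le)
  obtain ⟨A₁, -, hA₁⟩ := LInftySum.exists_clm_of_diagonal A hA
  obtain ⟨B₁, -, hB₁⟩ := LInftySum.exists_clm_of_diagonal B hB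
  let S : LInftySum X →L[ℝ] LInftySum X := A₁ ∘L T ∘L B₁
  have hS : ∀ q z, arrayCoord e q.1 q.2 (S z) = f q (T (B₁ z) q.1) := by
    intro q z
    rw [arrayCoord_apply]
    change e.coord q.2 (A₁ (T (B₁ z)) q.1) = _
    rw [hA₁, hAf]
  have hSe : ∀ q s : ℕ × ℕ, arrayCoord e q.1 q.2 (S (arrayVec e s.1 s.2)) =
      f q (τ q.1 s.1 (x s)) := by
    intro q s
    rw [hS, arrayVec_eq, LInftySum.clm_apply_incl hB₁, hBe]
    rfl
  have hSn : ∀ q : ℕ × ℕ, LInftySum.IsNormal (arrayCoord e q.1 q.2 ∘L S) := by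
    intro q
    -- Normality is assumed only for the coordinates of `T`; it passes to `f q` because this is a
    -- finite combination of coordinate functionals.
    have h0 : ∀ g ∈ Submodule.span ℝ (Set.range e.coord),
        LInftySum.IsNormal (g ∘L lp.evalCLM ℝ (fun _ : ℕ => X) ⊤ q.1 ∘L T) := by
      intro g hg
      induction hg using Submodule.span_induction with
      | mem g hg => obtain ⟨j, rfl⟩ := hg; exact hT (q.1, j)
      | zero => exact LInftySum.isNormal_zero
      | add g h _ _ hg hh => exact hg.add hh
      | smul c g _ hg => exact hg.smul c
    have h2 := (h0 _ (hfspan q)).comp_diagonal hB₁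
    convert h2 using 1
    ext z
    exact hS q z
  let w : ℕ × ℕ → ℝ := fun q => (1 / 2 : ℝ) ^ ν q
  have hw : HasSum w 2 := ν.hasSum_iff.2 hasSum_geometric_two
  let a : ℕ × ℕ → ℕ × ℕ → ℝ := fun q s => if q = s then 0 else f q (τ q.1 s.1 (x s))
  -- A tolerance of order `4⁻ⁿ` at the later turn `n` splits into a product of summable weights for
  -- both turns.
  have hpow : ∀ m n : ℕ, m < n → (1 / 4 : ℝ) ^ n ≤ (1 / 2) ^ m * (1 / 2) ^ n := by
    intro m n hmn
    rw [show (1 / 4 : ℝ) = 1 / 2 * (1 / 2) by norm_num, mul_pow]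
    exact mul_le_mul_of_nonneg_right
      (pow_le_pow_of_le_one (by norm_num) (by norm_num) hmn.le) (by positivity)
  have ha : ∀ q s, |a q s| ≤ (M * θ) * (w q * w s) := by
    intro q s
    by_cases hqs : q = s
    · simp only [a, hqs, if_true, abs_zero, w]; positivity
    · simp only [a, hqs, if_false]
      rcases lt_or_gt_of_ne (fun h => hqs (ν.injective h) : ν q ≠ ν s) with h | h
      · calc |f q (τ q.1 s.1 (x s))| ≤ ‖f q‖ * ‖τ q.1 s.1‖ * (θ * (1 / 4) ^ ν s) := hoff1 s q h
          _ ≤ (√(C + 1 / 2) * (2 * κ)) * ‖T‖ * (θ * ((1 / 2) ^ ν q * (1 / 2) ^ ν s)) := by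
            gcongr
            · exact hfn q
            · exact hτ _ _
            · exact hpow _ _ h
          _ = (M * θ) * (w q * w s) := by simp only [hM, w]; ring
      · calc |f q (τ q.1 s.1 (x s))| ≤ ‖τ q.1 s.1‖ * ‖x s‖ * (θ * (1 / 4) ^ ν q) := hoff2 q s h
          _ ≤ ‖T‖ * (√(C + 1 / 2) * (2 * κ)) * (θ * ((1 / 2) ^ ν s * (1 / 2) ^ ν q)) := by
            gcongr
            · exact hτ _ _
            · exact hxn s
            · exact hpow _ _ h
          _ = (M * θ) * (w q * w s) := by simp only [hM, w]; ring
  obtain ⟨N, hN, hNn, hNe⟩ := exists_clm_of_summable_matrix he hκ hw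
    (fun q => by positivity) ha
  let d : ℕ × ℕ → ℝ := fun q => f q (τ q.1 q.1 (x q))
  have hD : ∀ q : ℕ × ℕ, arrayCoord e q.1 q.2 ∘L (S - N) = d q • arrayCoord e q.1 q.2 := by
    intro q
    refine LInftySum.IsNormal.ext_arrayVec e ?_ ((isNormal_arrayCoord e q).smul _) fun s => ?_
    · rw [ContinuousLinearMap.comp_sub]; exact (hSn q).sub (hNn q)
    · rw [ContinuousLinearMap.comp_apply, sub_apply, map_sub, hSe, hNe,
        smul_apply, smul_eq_mul]
      by_cases hqs : q = s
      · subst hqs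
        rw [arrayCoord_arrayVec_self]; simp [a, d]
      · rw [arrayCoord_arrayVec_of_ne e hqs]; simp [a, hqs]
  -- The bound `δ / 2` is `δ * (1 - η)` for `η = 1 / 2`.
  obtain ⟨A₂, B₂, hA₂, hB₂, hAB⟩ := hdiag.exists_factors he (by positivity : 0 < δ / 2)
    (fun q => (show δ / 2 ≤ |d q| by have := hfx q; linarith)) hD
  have hsmall : ‖A₂ ∘L N ∘L B₂‖ < 1 := by
    have h1 : ‖A₂ ∘L N ∘L B₂‖ ≤ Q * ((M * θ * (2 * 2) * (2 * κ)) * 1) := by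
      refine (ContinuousLinearMap.opNorm_comp_le _ _).trans ?_
      refine mul_le_mul hA₂ ?_ (norm_nonneg _) hQ0.le
      exact (ContinuousLinearMap.opNorm_comp_le _ _).trans
        (mul_le_mul hN hB₂ (norm_nonneg _) (by positivity))
    refine h1.trans_lt ?_
    have h2 : Q * ((M * θ * (2 * 2) * (2 * κ)) * 1) = (8 * κ * Q * M) / (8 * κ * Q * M + 1) := by
      rw [hθ]; ring
    rw [h2, div_lt_one (by positivity)]
    linarith
  obtain ⟨V, hV⟩ := isUnit_id_add_of_norm_lt_one hsmall
  refine ⟨V ∘L A₂ ∘L A₁, B₁ ∘L B₂, ?_⟩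
  rw [← hV]
  ext1 z
  have h1 := hAB z
  rw [sub_apply, map_sub] at h1
  change V (A₂ (S (B₂ z))) = V (z + A₂ (N (B₂ z)))
  rw [← sub_eq_iff_eq_add.1 h1]

end Factorization

/-- `J` moves the component `l` to `φ l` and `R` reads the components `φ k` back, so `R T J` is a
compression of `T` whose diagonal consists of diagonal entries of `T`. -/
theorem LInftySum.exists_reduction_to_normal {X : Type*} [NormedAddCommGroup X] [NormedSpace ℝ X]
    (e : SchauderBasis ℝ X) (T : LInftySum X →L[ℝ] LInftySum X) :
    ∃ (φ : ℕ → ℕ) (R J : LInftySum X →L[ℝ] LInftySum X),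
      (∀ q : ℕ × ℕ, IsNormal (arrayCoord e q.1 q.2 ∘L (R ∘L T ∘L J))) ∧
      ∀ q : ℕ × ℕ, arrayCoord e q.1 q.2 ((R ∘L T ∘L J) (arrayVec e q.1 q.2)) =
        arrayCoord e (φ q.1) q.2 (T (arrayVec e (φ q.1) q.2)) := by
  obtain ⟨φ, J, hφ, hJ1, hJ2, hJn⟩ :=
    exists_normal_subsequence fun q : ℕ × ℕ => arrayCoord e q.1 q.2 ∘L T
  obtain ⟨R, hR⟩ := exists_reindex (X := X) φ
  have hJi : ∀ l x, J (incl l x) = incl (φ l) x := by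
    intro l x
    ext k
    by_cases hk : ∃ n, φ n = k
    · obtain ⟨n, rfl⟩ := hk
      rw [hJ1]
      by_cases hn : n = l
      · subst hn; rw [incl_apply_self, incl_apply_self]
      · rw [incl_apply_ne hn, incl_apply_ne fun h => hn (hφ h)]
    · push Not at hk
      rw [hJ2 _ _ hk, incl_apply_ne (hk l).symm]
  have hc : ∀ (q : ℕ × ℕ) z, arrayCoord e q.1 q.2 ((R ∘L T ∘L J) z) =
      arrayCoord e (φ q.1) q.2 (T (J z)) := fun q z =>
    congrArg (e.coord q.2) (hR (T (J z)) q.1)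
  refine ⟨φ, R, J, fun q => ?_, fun q => ?_⟩
  · convert hJn (φ q.1, q.2) using 1
    ext z
    exact hc q z
  · rw [hc, arrayVec_eq, hJi]; rfl

end

theorem corollary3p5 {X : Type*} [NormedAddCommGroup X] [NormedSpace ℝ X] [CompleteSpace X]
    (e : SchauderBasis ℝ X) (he : ∀ j, ‖e j‖ = 1)
    (C : ℝ) (hC : 1 ≤ C) (hrep : IsStrategicallyReproducible e C)
    (K : ℝ → ℝ) (hK : ∀ δ, 0 < δ → 0 < K δ) (hdiag : HasDiagonalFactorizationProperty e K) :
    (IsSimultaneouslyStrategicallyReproducible (fun _ : ℕ => e) C ∧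
      ∀ ν : ℕ × ℕ ≃ ℕ, (∀ k i j, ν (k, i) < ν (k, j) ↔ i < j) →
        ∀ η : ℝ, 0 < η → PlayerTwoWinsArrayRep ν (fun _ : ℕ => e) C η) ∧
    ∀ T : LInftySum X →L[ℝ] LInftySum X, HasLargeDiagonal e T → IdentityFactorsThrough T := by
  refine ⟨⟨fun _ => hrep, fun ν hν η hη =>
    playerTwoWinsArrayRep_of_isStrategicallyReproducible hrep hν hη⟩, fun T hT => ?_⟩
  obtain ⟨φ, R, J, hn, hd⟩ := LInftySum.exists_reduction_to_normal e T
  obtain ⟨A, B, hAB⟩ := identityFactorsThrough_of_isNormal he hrep hK hdiag hn hT fun q => by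
    rw [hd]
    exact ciInf_le ⟨0, by rintro _ ⟨_, rfl⟩; exact abs_nonneg _⟩ (φ q.1, q.2)
  exact ⟨A ∘L R, J ∘L B, hAB⟩
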